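/- **Theorem (Morita).** Let $g,d\ge 1$. Let $\Sigma=\Sigma_g^1$ be a compact oriented surface of genus $g$ with one boundary component, let $*\in\partial\Sigma$, $\pi=\pi_1(\Sigma,*)$ and $H=H_1(\Sigma;\mathbb Q)=\pi^{\mathrm{ab}}\otimes\mathbb Q$, and let $\omega$ be the algebraic intersection form on $H$. Let $\mathrm{Mod}_g^1$ be the group of isotopy classes (rel $\partial\Sigma$) of homeomorphisms of $\Sigma$ fixing $\partial\Sigma$ pointwise; it acts on $\pi$. Put $\gamma_1(\pi)=\pi$, $\gamma_{k+1}(\pi)=[\pi,\gamma_k(\pi)]$, and let $$\mathcal I_g^1[d]=\ker\bigl(\mathrm{Mod}_g^1\to\mathrm{Aut}(\pi/\gamma_{d+1}(\pi))\bigr)$$ be the $d$-th term of the Johnson filtration. Let $\mathcal L(H)=\bigoplus_{k\ge1}\mathcal L_k(H)$ be the free Lie algebra on $H$, realized as the Lie subalgebra generated by $H$ in the tensor algebra of $H$ and graded by tensor degree. For $w\in\gamma_k(\pi)$ let $[\![w]\!]_k\in\mathcal L_k(H)$ be its image under the identification $\gamma_k(\pi)/\gamma_{k+1}(\pi)\otimes\mathbb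 Q\cong\mathcal L_k(H)$, that is, under the unique family of homomorphisms $[\![\cdot]\!]_k:\gamma_k(\pi)\to\mathcal L_k(H)$, $k\ge 1$, such that $[\![x]\!]_1$ is the homology class of $x\in\pi$ and $[\![\,xwx^{-1}w^{-1}]\!]_{k+1}=[\,[\![x]\!]_1,[\![w]\!]_k]$ for $x\in\pi$, $w\in\gamma_k(\pi)$. The $d$-th Johnson homomorphism is the unique homomorphism $$\tau_d:\mathcal I_g^1[d]\to H\otimes\mathcal L_{d+1}(H)$$ such that, for every $f\in\mathcal I_g^1[d]$, the map $H\to\mathcal L_{d+1}(H)$ corresponding to $\tau_d(f)$ under the identification $y\otimes\kappa\mapsto(h\mapsto\omega(y,h)\,\kappa)$ sends the homology class of each $x\in\pi$ to $[\![f(x)x^{-1}]\!]_{d+1}$. Then $\omega$, the maps $[\![\cdot]\!]_k$ and $\tau_d$ are well defined (they exist and are unique), and the image of $\tau_d$ is contained in the kernel of the Lie bracket map $$H\otimes\mathcal L_{d+1}(H)\to\mathcal L_{d+2}(H),\qquad h\otimes\kappa\mapsto[h,\kappa].$$ -/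

import Mathlib

open scoped TensorProduct

namespace Johnson

noncomputable section

open scoped commutatorElement

/-! ### The surface of genus `g` with one boundary component

The closed unit disc is regarded as a polygon with `4 g + 1` sides, numbered counterclockwise
from the point `1`; the sides are glued according to the word
`α₀ β₀ α₀⁻¹ β₀⁻¹ ⋯ α_{g-1} β_{g-1} α_{g-1}⁻¹ β_{g-1}⁻¹ δ`, in which the last side `δ` is left free. -/

/-- The closed unit disc. -/
abbrev Disc : Type := Metric.closedBall (0 : ℂ) 1

/-- The point at time `t` on side number `k` of the `(4 g + 1)`-gon. -/
def sidePoint (g k : ℕ) (t : unitInterval) : Disc :=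
  ⟨(Circle.exp (2 * Real.pi * ((k + (t : ℝ)) / (4 * g + 1))) : ℂ), by
    rw [mem_closedBall_zero_iff, Circle.norm_coe]⟩

/-- The side pairing: sides `4 i` and `4 i + 2`, and sides `4 i + 1` and `4 i + 3`, are
identified with reversed directions, for `i < g`. -/
inductive SideRel (g : ℕ) : Disc → Disc → Prop
  | alpha (i : Fin g) (t : unitInterval) :
      SideRel g (sidePoint g (4 * i) t) (sidePoint g (4 * i + 2) (unitInterval.symm t))
  | beta (i : Fin g) (t : unitInterval) :
      SideRel g (sidePoint g (4 * i + 1) t) (sidePoint g (4 * i + 3) (unitInterval.symm t))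

/-- The compact orientable surface `Σ_g^1` of genus `g` with one boundary component. -/
def Surface (g : ℕ) : Type := Quot (SideRel g)

instance (g : ℕ) : TopologicalSpace (Surface g) :=
  inferInstanceAs (TopologicalSpace (Quot (SideRel g)))

/-- The quotient map from the polygon to the surface. -/
def toSurface (g : ℕ) (z : Disc) : Surface g := Quot.mk _ z

/-- The boundary circle `∂Σ_g^1`: the image of the free side. -/
def boundary (g : ℕ) : Set (Surface g) :=
  Set.range fun t : unitInterval => toSurface g (sidePoint g (4 * g) t)

/-- The basepoint: the common image of all the vertices of the polygon. -/
def basept (g : ℕ) : Surface g := toSurface g (sidePoint g 0 0)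

theorem continuous_sidePoint (g k : ℕ) : Continuous (sidePoint g k) := by
  unfold sidePoint
  fun_prop

theorem continuous_toSurface (g : ℕ) : Continuous (toSurface g) := continuous_quot_mk

theorem sidePoint_one (g k : ℕ) : sidePoint g k 1 = sidePoint g (k + 1) 0 := by
  simp [sidePoint]

theorem sidePoint_last (g : ℕ) : sidePoint g (4 * g) 1 = sidePoint g 0 0 := by
  have h : (4 * (g : ℝ) + 1) ≠ 0 := by positivity
  simp [sidePoint, div_self h]

theorem basept_mem_boundary (g : ℕ) : basept g ∈ boundary g :=
  ⟨1, by simp only [basept, sidePoint_last]⟩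

theorem vertex_step (g : ℕ) (i : Fin g) :
    toSurface g (sidePoint g (4 * i) 0) = toSurface g (sidePoint g (4 * i + 3) 0) ∧
    toSurface g (sidePoint g (4 * i + 1) 0) = toSurface g (sidePoint g (4 * i + 2) 0) ∧
    toSurface g (sidePoint g (4 * i + 1) 0) = toSurface g (sidePoint g (4 * i + 4) 0) ∧
    toSurface g (sidePoint g (4 * i + 2) 0) = toSurface g (sidePoint g (4 * i + 3) 0) := by
  have a0 : toSurface g _ = toSurface g _ := Quot.sound (SideRel.alpha i 0)
  have a1 : toSurface g _ = toSurface g _ := Quot.sound (SideRel.alpha i 1)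
  have b0 : toSurface g _ = toSurface g _ := Quot.sound (SideRel.beta i 0)
  have b1 : toSurface g _ = toSurface g _ := Quot.sound (SideRel.beta i 1)
  simp only [unitInterval.symm_zero, unitInterval.symm_one, sidePoint_one] at a0 a1 b0 b1
  exact ⟨a0, a1, b0, b1⟩

theorem vertex_four_mul (g : ℕ) (k : ℕ) (hk : k ≤ g) :
    toSurface g (sidePoint g (4 * k) 0) = basept g := by
  induction k with
  | zero => rfl
  | succ k ih =>
    obtain ⟨h1, h2, h3, h4⟩ := vertex_step g ⟨k, hk⟩
    rw [show 4 * (k + 1) = 4 * k + 4 by ring, ← ih (Nat.le_of_succ_le hk)]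
    exact (h3.symm.trans h2).trans (h4.trans h1.symm)

theorem vertex_alpha_zero (g : ℕ) (i : Fin g) :
    toSurface g (sidePoint g (4 * i) 0) = basept g :=
  vertex_four_mul g i i.2.le

theorem vertex_beta_one (g : ℕ) (i : Fin g) :
    toSurface g (sidePoint g (4 * i + 1) 1) = basept g := by
  obtain ⟨h1, h2, h3, h4⟩ := vertex_step g i
  rw [sidePoint_one, ← vertex_alpha_zero g i]
  exact h4.trans h1.symm

theorem vertex_beta_zero (g : ℕ) (i : Fin g) :
    toSurface g (sidePoint g (4 * i + 1) 0) = basept g := by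
  obtain ⟨h1, h2, h3, h4⟩ := vertex_step g i
  rw [← vertex_alpha_zero g i]
  exact h2.trans (h4.trans h1.symm)

theorem vertex_alpha_one (g : ℕ) (i : Fin g) :
    toSurface g (sidePoint g (4 * i) 1) = basept g := by
  rw [sidePoint_one, vertex_beta_zero]

/-- The loop `α_i`: side `4 i` of the polygon. -/
def alphaLoop (g : ℕ) (i : Fin g) : Path (basept g) (basept g) where
  toFun t := toSurface g (sidePoint g (4 * i) t)
  continuous_toFun := (continuous_toSurface g).comp (continuous_sidePoint g _)
  source' := vertex_alpha_zero g i
  target' := vertex_alpha_one g i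

/-- The loop `β_i`: side `4 i + 1` of the polygon. -/
def betaLoop (g : ℕ) (i : Fin g) : Path (basept g) (basept g) where
  toFun t := toSurface g (sidePoint g (4 * i + 1) t)
  continuous_toFun := (continuous_toSurface g).comp (continuous_sidePoint g _)
  source' := vertex_beta_zero g i
  target' := vertex_beta_one g i

/-! ### Fundamental group and first homology -/

/-- `π = π₁(Σ_g^1, *)`. -/
abbrev Pi1 (g : ℕ) : Type := FundamentalGroup (Surface g) (basept g)

/-- The class of a loop in `π`. -/
def loopClass {g : ℕ} (p : Path (basept g) (basept g)) : Pi1 g :=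
  FundamentalGroup.fromPath (Path.Homotopic.Quotient.mk p)

/-- `H = H₁(Σ_g^1; ℚ) = π^ab ⊗ ℚ`. -/
abbrev H1 (g : ℕ) : Type := ℚ ⊗[ℤ] Additive (Abelianization (Pi1 g))

/-- The homology class of an element of `π`. -/
def hclass {g : ℕ} (x : Pi1 g) : H1 g := 1 ⊗ₜ[ℤ] Additive.ofMul (Abelianization.of x)

/-- `ω` is the algebraic intersection form on `H`: the alternating bilinear form with
`a_i · b_j = δ_{ij}` and `a_i · a_j = b_i · b_j = 0`, where `a_i`, `b_i` are the homology classes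
of the side loops `α_i`, `β_i`. (These classes form a basis of `H`, so this determines `ω`.) -/
structure IsIntersectionForm (g : ℕ) (ω : LinearMap.BilinForm ℚ (H1 g)) : Prop where
  alt : ω.IsAlt
  alpha_alpha : ∀ i j : Fin g,
    ω (hclass (loopClass (alphaLoop g i))) (hclass (loopClass (alphaLoop g j))) = 0
  beta_beta : ∀ i j : Fin g,
    ω (hclass (loopClass (betaLoop g i))) (hclass (loopClass (betaLoop g j))) = 0
  alpha_beta : ∀ i j : Fin g,
    ω (hclass (loopClass (alphaLoop g i))) (hclass (loopClass (betaLoop g j))) =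
      if i = j then 1 else 0

/-! ### The mapping class group and its action on `π` -/

/-- The group of homeomorphisms of `Σ_g^1` that fix the boundary pointwise. (Since the boundary is
nonempty, such homeomorphisms preserve the orientation.) -/
def homeoRelBoundary (g : ℕ) : Subgroup (Surface g ≃ₜ Surface g) where
  carrier := {f | ∀ x ∈ boundary g, f x = x}
  one_mem' := fun _ _ => rfl
  mul_mem' := by
    intro f h hf hh x hx
    rw [Homeomorph.mul_apply, hh x hx, hf x hx]
  inv_mem' := by
    intro f hf x hx
    have := hf x hx
    calc f⁻¹ x = f⁻¹ (f x) := by rw [this]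
      _ = x := f.symm_apply_apply x

/-- The normal subgroup of the homeomorphisms isotopic to the identity, by an isotopy through
homeomorphisms that fix the boundary pointwise. -/
def isotopicToId (g : ℕ) : Subgroup (homeoRelBoundary g) where
  carrier := {f | ∃ F : unitInterval → homeoRelBoundary g,
    Continuous (fun p : unitInterval × Surface g => (F p.1).1 p.2) ∧ F 0 = 1 ∧ F 1 = f}
  one_mem' := ⟨fun _ => 1, continuous_snd, rfl, rfl⟩
  mul_mem' := by
    rintro f h ⟨F, hF, F0, F1⟩ ⟨K, hK, K0, K1⟩
    exact ⟨fun t => F t * K t, hF.comp (continuous_fst.prodMk hK), by simp [F0, K0],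
      by simp [F1, K1]⟩
  inv_mem' := by
    rintro f ⟨F, hF, F0, F1⟩
    refine ⟨fun t => f⁻¹ * F (unitInterval.symm t), ?_, by simp [F1], by simp [F0]⟩
    exact (f⁻¹).1.continuous.comp
      (hF.comp ((unitInterval.continuous_symm.comp continuous_fst).prodMk continuous_snd))

instance isotopicToId_normal (g : ℕ) : (isotopicToId g).Normal where
  conj_mem := by
    rintro f ⟨F, hF, F0, F1⟩ h
    refine ⟨fun t => h * F t * h⁻¹, ?_, by simp [F0], by simp [F1]⟩
    exact h.1.continuous.comp
      (hF.comp (continuous_fst.prodMk ((h⁻¹).1.continuous.comp continuous_snd)))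

/-- The mapping class group `Mod_g^1`. -/
abbrev MCG (g : ℕ) : Type := homeoRelBoundary g ⧸ isotopicToId g

theorem homeo_basept {g : ℕ} (f : homeoRelBoundary g) : f.1 (basept g) = basept g :=
  f.2 _ (basept_mem_boundary g)

/-- The endomorphism of `π` induced by a homeomorphism that fixes the boundary. -/
def inducedHom {g : ℕ} (f : homeoRelBoundary g) : Pi1 g →* Pi1 g :=
  FundamentalGroup.mapOfEq (f.1 : C(Surface g, Surface g)) (homeo_basept f)

theorem inducedHom_loopClass {g : ℕ} (f : homeoRelBoundary g) (p : Path (basept g) (basept g)) :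
    inducedHom f (loopClass p) =
      loopClass ((p.map f.1.continuous).cast (homeo_basept f).symm (homeo_basept f).symm) := by
  exact FundamentalGroup.mapOfEq_apply _ _ _

theorem loopClass_surjective {g : ℕ} (x : Pi1 g) : ∃ p, loopClass p = x := by
  induction x using Quotient.inductionOn with
  | h p => exact ⟨p, rfl⟩

theorem inducedHom_one (g : ℕ) : inducedHom (1 : homeoRelBoundary g) = MonoidHom.id _ := by
  ext x
  obtain ⟨p, rfl⟩ := loopClass_surjective x
  rw [inducedHom_loopClass]
  rfl

theorem inducedHom_mul {g : ℕ} (f h : homeoRelBoundary g) :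
    inducedHom (f * h) = (inducedHom f).comp (inducedHom h) := by
  ext x
  obtain ⟨p, rfl⟩ := loopClass_surjective x
  rw [MonoidHom.comp_apply, inducedHom_loopClass, inducedHom_loopClass, inducedHom_loopClass]
  rfl

theorem inducedHom_of_isotopic {g : ℕ} (f : homeoRelBoundary g) (hf : f ∈ isotopicToId g) :
    inducedHom f = MonoidHom.id _ := by
  obtain ⟨F, hF, F0, F1⟩ := hf
  ext x
  obtain ⟨p, rfl⟩ := loopClass_surjective x
  rw [inducedHom_loopClass, MonoidHom.id_apply]
  refine Quotient.sound (Path.Homotopic.symm ⟨?_⟩)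
  exact
    { toFun := fun q => (F q.1).1 (p q.2)
      continuous_toFun := hF.comp (continuous_fst.prodMk (p.continuous.comp continuous_snd))
      map_zero_left := fun t => by simp [F0]
      map_one_left := fun t => by simp [F1]
      prop' := by
        rintro t s (rfl | rfl)
        · simpa using homeo_basept (F t)
        · simpa using homeo_basept (F t) }

/-- The action of homeomorphisms on `π` by automorphisms. -/
def homeoAction (g : ℕ) : homeoRelBoundary g →* MulAut (Pi1 g) where
  toFun f := MonoidHom.toMulEquiv (inducedHom f) (inducedHom f⁻¹)
    (by rw [← inducedHom_mul, inv_mul_cancel, inducedHom_one])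
    (by rw [← inducedHom_mul, mul_inv_cancel, inducedHom_one])
  map_one' := by
    ext x
    exact DFunLike.congr_fun (inducedHom_one g) x
  map_mul' f h := by
    ext x
    exact DFunLike.congr_fun (inducedHom_mul f h) x

/-- The action of the mapping class group on `π`. -/
def mcgAction (g : ℕ) : MCG g →* MulAut (Pi1 g) :=
  QuotientGroup.lift (isotopicToId g) (homeoAction g) (by
    intro f hf
    ext x
    exact DFunLike.congr_fun (inducedHom_of_isotopic f hf) x)

/-! ### The Johnson filtration -/

/-- The lower central series of `π`, with `γ_1(π) = π`. (The value at `0` is `π`.) -/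
abbrev gam (g d : ℕ) : Subgroup (Pi1 g) := (⊤ : Subgroup (Pi1 g)).lowerCentralSeries (d - 1)

/-- The term `I_g^1[d]` of the Johnson filtration: the kernel of the action of `Mod_g^1` on
`π / γ_{d+1}(π)`. -/
def johnsonFiltration (g d : ℕ) : Subgroup (MCG g) where
  carrier := {f | ∀ x : Pi1 g,
    (QuotientGroup.mk (mcgAction g f x) : Pi1 g ⧸ gam g (d + 1)) = QuotientGroup.mk x}
  one_mem' := fun x => by simp
  mul_mem' := by
    intro f h hf hh x
    rw [map_mul, MulAut.mul_apply, hf, hh]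
  inv_mem' := by
    intro f hf x
    have h := hf (mcgAction g f⁻¹ x)
    rw [← MulAut.mul_apply, ← map_mul, mul_inv_cancel, map_one, MulAut.one_apply] at h
    exact h.symm

/-- For `f ∈ I_g^1[d]` and `x ∈ π`, the element `f(x) x⁻¹` of `γ_{d+1}(π)`. -/
def leftDiff {g d : ℕ} (f : johnsonFiltration g d) (x : Pi1 g) : gam g (d + 1) :=
  ⟨mcgAction g f.1 x * x⁻¹, by
    have h := (QuotientGroup.eq.mp (f.2 x).symm)
    have hn : (gam g (d + 1)).Normal := inferInstance
    exact hn.mem_comm h⟩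

/-! ### The free Lie algebra -/

section FreeLie

attribute [local instance] LieRing.ofAssociativeRing

variable (V : Type) [AddCommGroup V] [Module ℚ V]

/-- The free Lie algebra on the vector space `V`: the Lie subalgebra generated by `V` in the
tensor algebra of `V`, with bracket `[s, t] = s t - t s`. -/
def freeLie : LieSubalgebra ℚ (TensorAlgebra ℚ V) :=
  LieSubalgebra.lieSpan ℚ (TensorAlgebra ℚ V) (Set.range (TensorAlgebra.ι ℚ))

/-- The graded piece of degree `d` of the free Lie algebra: its elements that are homogeneous of
degree `d` in the tensor algebra. -/
def freeLieDeg (d : ℕ) : Submodule ℚ (TensorAlgebra ℚ V) :=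
  (freeLie V).toSubmodule ⊓ LinearMap.range (TensorAlgebra.ι ℚ : V →ₗ[ℚ] TensorAlgebra ℚ V) ^ d

variable {V}

theorem ι_mem_freeLieDeg (v : V) : TensorAlgebra.ι ℚ v ∈ freeLieDeg V 1 :=
  ⟨LieSubalgebra.subset_lieSpan ⟨v, rfl⟩, by rw [pow_one]; exact ⟨v, rfl⟩⟩

theorem lie_ι_mem_freeLieDeg (v : V) {d : ℕ} {u : TensorAlgebra ℚ V} (hu : u ∈ freeLieDeg V d) :
    ⁅TensorAlgebra.ι ℚ v, u⁆ ∈ freeLieDeg V (d + 1) := by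
  refine ⟨(freeLie V).lie_mem (LieSubalgebra.subset_lieSpan ⟨v, rfl⟩) hu.1, ?_⟩
  rw [Ring.lie_def]
  refine Submodule.sub_mem _ ?_ ?_
  · rw [pow_succ']
    exact Submodule.mul_mem_mul ⟨v, rfl⟩ hu.2
  · rw [pow_succ]
    exact Submodule.mul_mem_mul hu.2 ⟨v, rfl⟩

variable (V)

/-- The inclusion of `V` as the degree `1` part of the free Lie algebra. -/
def freeLieGen : V →ₗ[ℚ] freeLieDeg V 1 :=
  (TensorAlgebra.ι ℚ).codRestrict _ ι_mem_freeLieDeg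

/-- The bracket `(v, u) ↦ [v, u]` with elements of degree `1`. -/
def lieGen (d : ℕ) : V →ₗ[ℚ] freeLieDeg V d →ₗ[ℚ] freeLieDeg V (d + 1) :=
  LinearMap.mk₂ ℚ (fun v u => ⟨⁅TensorAlgebra.ι ℚ v, u.1⁆, lie_ι_mem_freeLieDeg v u.2⟩)
    (fun v w u => Subtype.ext (by simp))
    (fun c v u => Subtype.ext (by simp))
    (fun v u w => Subtype.ext (by simp))
    (fun c v u => Subtype.ext (by simp))

/-- The Lie bracket map `V ⊗ L_d(V) → L_{d+1}(V)`, `v ⊗ u ↦ [v, u]`. -/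
def lieBracketMap (d : ℕ) : V ⊗[ℚ] freeLieDeg V d →ₗ[ℚ] freeLieDeg V (d + 1) :=
  TensorProduct.lift (lieGen V d)

end FreeLie

/-! ### The symbol maps and the Johnson homomorphism -/

/-- The commutator `[x, w]` of `x ∈ π` and `w ∈ γ_{n+1}(π)`, as an element of `γ_{n+2}(π)`. -/
def commElt {g n : ℕ} (x : Pi1 g) (w : gam g (n + 1)) : gam g (n + 2) :=
  ⟨⁅x, w.1⁆, by
    have h : ⁅w.1, x⁆ ∈ gam g (n + 2) :=
      Subgroup.commutator_mem_commutator w.2 (Subgroup.mem_top x)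
    rw [← commutatorElement_inv]
    exact inv_mem h⟩

/-- The family `σ_n : γ_{n+1}(π) → L_{n+1}(H)`, `w ↦ ⟦w⟧_{n+1}`, of homomorphisms expresses the
identification of the Lie algebra `⨁ γ_k(π)/γ_{k+1}(π) ⊗ ℚ` with the free Lie algebra on
`H = γ_1(π)/γ_2(π) ⊗ ℚ`: it is the identity in degree `1` and takes commutators to brackets.
As `γ_{n+2}(π)` is generated by the commutators `[x, w]` with `x ∈ π` and `w ∈ γ_{n+1}(π)`, these
conditions determine it, and they imply that `σ_n` vanishes on `γ_{n+2}(π)`. -/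
structure IsSymbol (g : ℕ)
    (σ : ∀ n : ℕ, Additive (gam g (n + 1)) →+ freeLieDeg (H1 g) (n + 1)) : Prop where
  degree_one : ∀ x : gam g 1, σ 0 (Additive.ofMul x) = freeLieGen (H1 g) (hclass x.1)
  commutator : ∀ (n : ℕ) (x : Pi1 g) (w : gam g (n + 1)),
    σ (n + 1) (Additive.ofMul (commElt x w)) =
      lieGen (H1 g) (n + 1) (hclass x) (σ n (Additive.ofMul w))

/-- The linear map `H ⊗ L → L`, `y ⊗ κ ↦ ω(y, h) κ`. As `h` varies, this is the identification of
`H ⊗ L` with `Hom(H, L)` given by `ω`. -/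
def contract {V L : Type} [AddCommGroup V] [Module ℚ V] [AddCommGroup L] [Module ℚ L]
    (ω : LinearMap.BilinForm ℚ V) (h : V) : V ⊗[ℚ] L →ₗ[ℚ] L :=
  (TensorProduct.lid ℚ L).toLinearMap ∘ₗ LinearMap.rTensor L (ω.flip h)

/-- `τ` is the `d`-th Johnson homomorphism `I_g^1[d] → H ⊗ L_{d+1}(H)`: under the identification
of `H ⊗ L_{d+1}(H)` with `Hom(H, L_{d+1}(H)) = Hom(π, L_{d+1}(H))` given by `ω`, the element
`τ(f)` is the map `x ↦ ⟦f(x) x⁻¹⟧_{d+1}`. -/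
def IsJohnsonHom (g d : ℕ) (ω : LinearMap.BilinForm ℚ (H1 g))
    (σ : ∀ n : ℕ, Additive (gam g (n + 1)) →+ freeLieDeg (H1 g) (n + 1))
    (τ : Additive (johnsonFiltration g d) →+ H1 g ⊗[ℚ] freeLieDeg (H1 g) (d + 1)) : Prop :=
  ∀ (f : johnsonFiltration g d) (x : Pi1 g),
    contract ω (hclass x) (τ (Additive.ofMul f)) = σ d (Additive.ofMul (leftDiff f x))

end

end Johnson

/-! A mapping class fixes the boundary of the surface, and the boundary loop is, up to inversion, a
product of commutators of the side loops. The theorem is the lowest-order term of the equation `f(∂)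
= ∂`.

Write `a_i`, `b_i` for the classes of the side loops. For `f` in the `d`-th term of the filtration,
`x ↦ ⟦f(x) x⁻¹⟧` is additive and so factors through a linear map `φ : H → L_{d+1}(H)`, which
`johnsonLinear` constructs. Since `ω(a_i, b_i) = 1`, the tensor that corresponds to `φ` is `∑ (a_i ⊗
φ(b_i) - b_i ⊗ φ(a_i))`, called `dualTensor φ`, and its bracket is `∑ ([a_i, φ(b_i)] - [b_i,
φ(a_i)])`. To lowest order, `f` changes a commutator of `x` and `y` by `[φ(x), y] + [x, φ(y)]`.
Adding this over the handles of the boundary word gives minus the bracket above, and the change is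
zero because the word is fixed (`sum_handleTerm`).

Everything is computed in the Magnus expansion, which sends a side loop of class `h` to `1 + h X` in
power series over the tensor algebra; the central variable `X` records the degree. Leading
coefficients of elements of `γ_k(π)` are Lie elements (`gam_le_magnusSubgroup`), which gives the
symbol maps. The rule for commutators is `coeff_commutator_sub`.

The expansion requires `π` to be free on the side loops (`lift_genLoop_bijective`). The polygon
retracts onto its glued sides, so the surface deforms onto a one-point union of `2 g` circles. The
circles generate its fundamental group by a local argument (`wedgeSubgroup_eq_top`), and they are
free because the covering with fibre the free group has left translations as monodromy
(`wedge_lift_injective`). Freeness also makes the `a_i`, `b_i` a basis of `H`, hence `ω` exists and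
is unique. -/

namespace Johnson

noncomputable section

open scoped commutatorElement

/-! ### Loops generated locally -/

section LocalGeneration

open scoped unitInterval Topology

variable {X : Type*} [TopologicalSpace X] {x₀ : X}

/-- The class of the loop obtained by joining the ends of `p` to the basepoint along `ρ`. -/
def conjLoop (ρ : ∀ x, Path x₀ x) {x y : X} (p : Path x y) : FundamentalGroup X x₀ :=
  FundamentalGroup.fromPath (Path.Homotopic.Quotient.mk ((ρ x).trans (p.trans (ρ y).symm)))

variable (ρ : ∀ x, Path x₀ x)

theorem conjLoop_congr {x y : X} {p q : Path x y} (h : p.Homotopic q) :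
    conjLoop ρ p = conjLoop ρ q :=
  Path.Homotopic.Quotient.eq.mpr ((Path.Homotopic.refl _).hcomp (h.hcomp (Path.Homotopic.refl _)))

/-- Endpoints that are equal only propositionally cause no casts, since the value of `conjLoop` has
a type independent of them. -/
theorem conjLoop_eq_of_forall {x y x' y' : X} {p : Path x y} {q : Path x' y'}
    (h : ∀ t, p t = q t) : conjLoop ρ p = conjLoop ρ q := by
  obtain rfl : x = x' := by simpa using h 0
  obtain rfl : y = y' := by simpa using h 1
  obtain rfl : p = q := Path.ext (funext h)
  rfl

/-- The two copies of `ρ y` cancel. In `FundamentalGroup` a product traverses its right factor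
first, hence the reversed order. -/
theorem conjLoop_trans {x y z : X} (p : Path x y) (q : Path y z) :
    conjLoop ρ (p.trans q) = conjLoop ρ q * conjLoop ρ p := by
  rw [FundamentalGroup.mul_def]
  simp only [conjLoop, FundamentalGroup.fromPath, FundamentalGroup.fromArrow,
    Path.Homotopic.Quotient.mk_trans, Path.Homotopic.Quotient.mk_symm]
  grind

theorem conjLoop_refl (x : X) : conjLoop ρ (Path.refl x) = 1 := by
  rw [FundamentalGroup.one_def]
  simp only [conjLoop, FundamentalGroup.fromPath, FundamentalGroup.fromArrow,
    Path.Homotopic.Quotient.mk_trans, Path.Homotopic.Quotient.mk_symm]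
  simp

theorem conjLoop_symm {x y : X} (p : Path x y) : conjLoop ρ p.symm = (conjLoop ρ p)⁻¹ := by
  refine eq_inv_of_mul_eq_one_left ?_
  rw [← conjLoop_trans, conjLoop_congr ρ (Path.Homotopic.trans_symm p), conjLoop_refl]

variable {ρ}

theorem conjLoop_loop (hρ : ρ x₀ = Path.refl x₀) (p : Path x₀ x₀) :
    conjLoop ρ p = FundamentalGroup.fromPath (Path.Homotopic.Quotient.mk p) := by
  simp only [conjLoop, FundamentalGroup.fromPath, FundamentalGroup.fromArrow,
    Path.Homotopic.Quotient.mk_trans, Path.refl_symm, hρ]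
  simp

theorem conjLoop_tree (hρ : ρ x₀ = Path.refl x₀) (x : X) : conjLoop ρ (ρ x) = 1 := by
  rw [FundamentalGroup.one_def]
  simp only [conjLoop, FundamentalGroup.fromPath, FundamentalGroup.fromArrow,
    Path.Homotopic.Quotient.mk_trans, Path.Homotopic.Quotient.mk_symm, hρ]
  simp

/-- A subgroup of the fundamental group that contains the classes of all short paths, joined to
the basepoint along a fixed family of paths, is the whole group. -/
theorem eq_top_of_locally_conjLoop_mem (hρ : ρ x₀ = Path.refl x₀)
    (S : Subgroup (FundamentalGroup X x₀))
    (h : ∀ x, ∃ U ∈ 𝓝 x, ∀ (y z : X) (p : Path y z), Set.range p ⊆ U → conjLoop ρ p ∈ S) :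
    S = ⊤ := by
  refine (Subgroup.eq_top_iff' S).mpr fun c => ?_
  obtain ⟨γ, rfl⟩ := Path.Homotopic.Quotient.mk_surjective c
  -- Passing from `t` to a nearby `s` multiplies the class by that of a short path, which lies in
  -- `S`. Membership is thus locally constant on the connected interval; it holds at `0`, and at `1`
  -- it concerns `γ` itself.
  have hloc : IsLocallyConstant fun t : I => conjLoop ρ (γ.subpath 0 t) ∈ S := by
    rw [IsLocallyConstant.iff_eventually_eq]
    intro t
    obtain ⟨U, hU, hS⟩ := h (γ t)
    have hn : γ ⁻¹' U ∈ 𝓝 t := γ.continuous.continuousAt hU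
    obtain ⟨ε, hε, hball⟩ := Metric.mem_nhds_iff.mp hn
    filter_upwards [Metric.ball_mem_nhds t hε] with s hs
    have hsub : Set.range (γ.subpath t s) ⊆ U := by
      rw [Path.range_subpath]
      rintro _ ⟨r, hr, rfl⟩
      apply hball
      rw [Metric.mem_ball, Subtype.dist_eq, Real.dist_eq] at hs ⊢
      refine lt_of_le_of_lt ?_ hs
      have hr' : (r : ℝ) ∈ Set.uIcc (t : ℝ) s := by
        rcases Set.mem_uIcc.mp hr with h | h
        · exact Set.mem_uIcc.mpr (Or.inl h)
        · exact Set.mem_uIcc.mpr (Or.inr h)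
      exact Set.abs_sub_left_of_mem_uIcc hr'
    have hm : conjLoop ρ (γ.subpath t s) ∈ S := hS _ _ _ hsub
    rw [← conjLoop_congr ρ ⟨Path.Homotopy.subpathTransSubpath γ 0 t s⟩, conjLoop_trans]
    exact propext (Subgroup.mul_mem_cancel_left S hm)
  have h01 := hloc.apply_eq_of_preconnectedSpace 0 1
  have h0 : conjLoop ρ (γ.subpath 0 0) = 1 := by
    rw [conjLoop_eq_of_forall ρ (q := Path.refl x₀) (by simp), conjLoop_loop hρ]
    rfl
  have h1 : conjLoop ρ (γ.subpath 0 1) = FundamentalGroup.fromPath (.mk γ) := by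
    rw [← conjLoop_loop hρ, conjLoop_eq_of_forall ρ (q := γ) (by simp)]
  simp only [h0, h1, S.one_mem, eq_iff_iff, true_iff] at h01
  exact h01

theorem const_trans_homotopic {u v y : X} (c : Path u v) (b' : Path v y) (b : Path u y)
    (hc : ∀ t, c t = u) (hb : ∀ t, b' t = b t) : (c.trans b').Homotopic b := by
  obtain rfl : v = u := by simpa using hc 1
  obtain rfl : c = Path.refl _ := Path.ext (funext hc)
  obtain rfl : b' = b := Path.ext (funext hb)
  exact ⟨Path.Homotopy.reflTrans _⟩

/-- A square one side of which is constant gives a homotopy between the other sides. -/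
theorem trans_homotopic_of_square {u x y : X} (Φ : I × I → X) (hΦ : Continuous Φ)
    (a : Path u x) (p : Path x y) (b : Path u y) (h₀ : ∀ t, Φ (0, t) = u)
    (ha : ∀ s, Φ (s, 0) = a s) (hb : ∀ s, Φ (s, 1) = b s) (hp : ∀ t, Φ (1, t) = p t) :
    (a.trans p).Homotopic b := by
  let v : Path (0 : I) 1 := ⟨⟨fun t => t, continuous_id⟩, rfl, rfl⟩
  have hI : ContractibleSpace I :=
    (convex_Icc (0 : ℝ) 1).contractibleSpace (Set.nonempty_Icc.mpr zero_le_one)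
  -- The two routes from `(0, 0)` to `(1, 1)` along the edges of the square are homotopic in the
  -- square, and `Φ` carries the homotopy to `X`.
  have key := (SimplyConnectedSpace.paths_homotopic
    ((v.prod (Path.refl (0 : I))).trans ((Path.refl (1 : I)).prod v))
    (((Path.refl (0 : I)).prod v).trans (v.prod (Path.refl (1 : I))))).map ⟨Φ, hΦ⟩
  have hx : Φ (1, 0) = x := by simpa using ha 1
  have hu : Φ (0, 0) = u := h₀ 0
  have hy : Φ (1, 1) = y := by simpa using hb 1
  subst hx hu hy
  rw [Path.map_trans, Path.map_trans] at key
  have e1 : (v.prod (Path.refl (0 : I))).map hΦ = a := Path.ext (funext fun s => ha s)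
  have e2 : ((Path.refl (1 : I)).prod v).map hΦ = p := Path.ext (funext fun s => hp s)
  rw [← e1, ← e2]
  exact key.trans (const_trans_homotopic _ _ _ (fun t => h₀ t) fun s => hb s)

end LocalGeneration

/-! ### The one-point union of circles -/

section Wedge

open scoped unitInterval Topology

/-- The point of the circle at angle `2 π b`. -/
def turn (b : ℝ) : Circle := Circle.exp (2 * Real.pi * b)

@[fun_prop]
theorem continuous_turn : Continuous turn := by unfold turn; fun_prop

@[simp] theorem turn_zero : turn 0 = 1 := by simp [turn]

theorem turn_add (a b : ℝ) : turn (a + b) = turn a * turn b := by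
  simp [turn, mul_add, Circle.exp_add]

theorem turn_eq_one_iff {b : ℝ} : turn b = 1 ↔ ∃ n : ℤ, b = n := by
  rw [turn, Circle.exp_eq_one]
  have := Real.two_pi_pos.ne'
  refine exists_congr fun n => ?_
  rw [mul_comm (n : ℝ), mul_right_inj' this]

@[simp] theorem turn_intCast (n : ℤ) : turn n = 1 := turn_eq_one_iff.mpr ⟨n, rfl⟩

theorem turn_neg (a : ℝ) : turn (-a) = (turn a)⁻¹ := by
  rw [eq_inv_iff_mul_eq_one, ← turn_add]; simp

theorem turn_eq_turn_iff {a b : ℝ} : turn a = turn b ↔ ∃ n : ℤ, a = b + n := by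
  rw [← mul_inv_eq_one, ← turn_neg, ← turn_add, turn_eq_one_iff]
  exact exists_congr fun n => by constructor <;> intro h <;> linarith

@[simp] theorem turn_add_intCast (a : ℝ) (n : ℤ) : turn (a + n) = turn a := by simp [turn_add]

theorem coe_turn_half : (turn (1 / 2) : ℂ) = -1 := by
  rw [turn, Circle.coe_exp]
  push_cast
  rw [show 2 * (Real.pi : ℂ) * (1 / 2) * Complex.I = Real.pi * Complex.I by ring,
    Complex.exp_pi_mul_I]

/-- The angle of a point of the circle, in turns, in `(-1/2, 1/2]`. -/
def signedPhase (w : Circle) : ℝ := Complex.arg w / (2 * Real.pi)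

@[simp] theorem turn_signedPhase (w : Circle) : turn (signedPhase w) = w := by
  have := Real.two_pi_pos.ne'
  rw [turn, signedPhase, mul_div_cancel₀ _ this, Circle.exp_arg]

@[simp] theorem signedPhase_one : signedPhase 1 = 0 := by simp [signedPhase]

theorem signedPhase_mem (w : Circle) : signedPhase w ∈ Set.Ioc (-1 / 2 : ℝ) (1 / 2) := by
  have h := Complex.arg_mem_Ioc (w : ℂ)
  have := Real.pi_pos
  constructor
  · rw [signedPhase, lt_div_iff₀ (by positivity)]; linarith [h.1]
  · rw [signedPhase, div_le_iff₀ (by positivity)]; linarith [h.2]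

theorem continuousAt_signedPhase {w : Circle} (h : w ≠ turn (1 / 2)) :
    ContinuousAt signedPhase w := by
  have hs : (w : ℂ) ∈ Complex.slitPlane := by
    rw [Complex.mem_slitPlane_iff_arg]
    refine ⟨fun hw => h ?_, w.coe_ne_zero⟩
    rw [← turn_signedPhase w, signedPhase, hw]
    congr 1
    field_simp
  exact ((Complex.continuousAt_arg hs).comp continuous_subtype_val.continuousAt).div_const _

/-- The angle of a point of the circle, in turns, in `[0, 1)`. -/
def phase (w : Circle) : ℝ := Int.fract (signedPhase w)

@[simp] theorem turn_phase (w : Circle) : turn (phase w) = w := by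
  rw [phase, Int.fract, sub_eq_add_neg, ← Int.cast_neg, turn_add_intCast, turn_signedPhase]

theorem phase_turn (b : ℝ) : phase (turn b) = Int.fract b := by
  obtain ⟨n, hn⟩ := turn_eq_turn_iff.mp (turn_signedPhase (turn b))
  rw [phase, hn, Int.fract_add_intCast]

@[simp] theorem phase_one : phase 1 = 0 := by simp [phase]

/-- The one-point union of circles indexed by `ι`, inside their product. -/
abbrev Wedge (ι : Type) : Type := {z : ι → Circle // ∀ i j, i ≠ j → z i = 1 ∨ z j = 1}

variable {ι : Type}

/-- The common point of the circles. -/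
def wedgeBase (ι : Type) : Wedge ι := ⟨1, fun _ _ _ => Or.inl rfl⟩

theorem wedge_coord_eq_one {z : Wedge ι} {i : ι} (hi : z.1 i ≠ 1) (j : ι) (hj : j ≠ i) :
    z.1 j = 1 := (z.2 j i hj).resolve_right hi

theorem exists_wedge_index [Nonempty ι] (z : Wedge ι) : ∃ i, ∀ j, j ≠ i → z.1 j = 1 := by
  by_cases h : ∃ i, z.1 i ≠ 1
  · obtain ⟨i, hi⟩ := h
    exact ⟨i, wedge_coord_eq_one hi⟩
  · push Not at h
    exact ⟨Classical.arbitrary ι, fun j _ => h j⟩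

theorem wedge_phase_mem (z : Wedge ι) (f : Circle → ℝ) (hf : f 1 = 0) (s : ℝ) (i j : ι)
    (hij : i ≠ j) : turn (s * f (z.1 i)) = 1 ∨ turn (s * f (z.1 j)) = 1 := by
  rcases z.2 i j hij with h | h
  · exact Or.inl (by simp [h, hf])
  · exact Or.inr (by simp [h, hf])

/-- The path from the common point to `z` in the positive direction. -/
def wedgeTree (z : Wedge ι) : Path (wedgeBase ι) z where
  toFun t := ⟨fun i => turn (t * phase (z.1 i)), fun i j => wedge_phase_mem z _ phase_one _ i j⟩
  continuous_toFun := by fun_prop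
  source' := Subtype.ext (funext fun i => by simp [wedgeBase])
  target' := Subtype.ext (funext fun i => by simp)

theorem wedgeTree_apply (z : Wedge ι) (t : I) (i : ι) :
    (wedgeTree z t).1 i = turn (t * phase (z.1 i)) := rfl

theorem wedgeTree_base : wedgeTree (wedgeBase ι) = Path.refl _ := by
  refine Path.ext (funext fun t => Subtype.ext (funext fun i => ?_))
  rw [wedgeTree_apply]
  change turn (t * phase 1) = 1
  simp

/-- The shortest path from the common point to `z`. -/
def wedgeRadius (z : Wedge ι) : Path (wedgeBase ι) z where
  toFun t := ⟨fun i => turn (t * signedPhase (z.1 i)),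
    fun i j => wedge_phase_mem z _ signedPhase_one _ i j⟩
  continuous_toFun := by fun_prop
  source' := Subtype.ext (funext fun i => by simp [wedgeBase])
  target' := Subtype.ext (funext fun i => by simp)

theorem wedgeRadius_apply (z : Wedge ι) (t : I) (i : ι) :
    (wedgeRadius z t).1 i = turn (t * signedPhase (z.1 i)) := rfl

variable [DecidableEq ι]

/-- The point at angle `2 π b` on the circle number `i`. -/
def wedgePt (i : ι) (b : ℝ) : Wedge ι := ⟨Pi.mulSingle i (turn b), fun j k hjk => by
  by_cases h : j = i
  · exact Or.inr (Pi.mulSingle_eq_of_ne (fun h' => hjk (h.trans h'.symm)) _)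
  · exact Or.inl (Pi.mulSingle_eq_of_ne h _)⟩

@[fun_prop]
theorem continuous_wedgePt (i : ι) : Continuous (wedgePt i) :=
  ((continuous_mulSingle i).comp continuous_turn).subtype_mk _

theorem wedgePt_of_turn_eq {i : ι} {a b : ℝ} (h : turn a = turn b) : wedgePt i a = wedgePt i b :=
  Subtype.ext (by simp [wedgePt, h])

theorem wedgePt_of_turn_eq_one (i : ι) {a : ℝ} (h : turn a = 1) : wedgePt i a = wedgeBase ι :=
  Subtype.ext (by simp [wedgePt, wedgeBase, h])

theorem eq_wedgePt {z : Wedge ι} {i : ι} {b : ℝ} (hi : z.1 i = turn b)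
    (h : ∀ j, j ≠ i → z.1 j = 1) : z = wedgePt i b := by
  refine Subtype.ext (funext fun j => ?_)
  by_cases hj : j = i
  · subst hj; simpa [wedgePt] using hi
  · simp [wedgePt, hj, h j hj]

/-- The loop that runs once around the circle number `i`. -/
def wedgeLoop (i : ι) : Path (wedgeBase ι) (wedgeBase ι) where
  toFun t := wedgePt i t
  continuous_toFun := by fun_prop
  source' := wedgePt_of_turn_eq_one i (by simp)
  target' := wedgePt_of_turn_eq_one i (by simpa using turn_intCast 1)

/-- The segment from `a` to `b`. -/
def linePath (a b : ℝ) : Path a b where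
  toFun t := a + t * (b - a)
  continuous_toFun := by fun_prop
  source' := by simp
  target' := by simp

/-- The path on the circle number `i` from angle `2 π a` to angle `2 π b`. -/
def wedgeSeg (i : ι) (a b : ℝ) : Path (wedgePt i a) (wedgePt i b) :=
  (linePath a b).map (continuous_wedgePt i)

theorem wedgeSeg_apply (i : ι) (a b : ℝ) (t : I) :
    wedgeSeg i a b t = wedgePt i (a + t * (b - a)) := rfl

theorem wedgeSeg_trans (i : ι) (a b c : ℝ) :
    ((wedgeSeg i a b).trans (wedgeSeg i b c)).Homotopic (wedgeSeg i a c) := by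
  have h := (SimplyConnectedSpace.paths_homotopic
    ((linePath a b).trans (linePath b c)) (linePath a c)).map ⟨_, continuous_wedgePt i⟩
  rwa [Path.map_trans] at h

theorem wedgeTree_wedgePt (i : ι) (b : ℝ) (t : I) :
    wedgeTree (wedgePt i b) t = wedgePt i (t * Int.fract b) := by
  refine eq_wedgePt ?_ fun j hj => ?_
  · rw [wedgeTree_apply]
    simp [wedgePt, phase_turn]
  · rw [wedgeTree_apply]
    simp [wedgePt, hj]

/-- The subgroup generated by the circles. -/
def wedgeSubgroup (ι : Type) [DecidableEq ι] :
    Subgroup (FundamentalGroup (Wedge ι) (wedgeBase ι)) :=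
  Subgroup.closure (Set.range fun i =>
    FundamentalGroup.fromPath (Path.Homotopic.Quotient.mk (wedgeLoop i)))

/-- A segment that starts at the integer `⌊b⌋` is the tree path itself, because that path runs
through the fractional part of `b`. -/
theorem conjLoop_wedgeSeg_floor (i : ι) (a b : ℝ) (hn : (⌊b⌋ : ℝ) = a) :
    conjLoop wedgeTree (wedgeSeg i a b) = 1 := by
  rw [← conjLoop_tree wedgeTree_base (wedgePt i b)]
  refine conjLoop_eq_of_forall _ fun t => ?_
  rw [wedgeTree_wedgePt, wedgeSeg_apply]
  refine wedgePt_of_turn_eq ?_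
  rw [← hn, Int.self_sub_floor, add_comm, turn_add_intCast]

/-- For `b < 0`, going from `0` to `b` amounts to going once backwards around the circle and then
along the tree path from `-1` to `b`. -/
theorem conjLoop_wedgeSeg_mem (i : ι) (b : ℝ) (h₁ : -1 ≤ b) (h₂ : b < 1) :
    conjLoop wedgeTree (wedgeSeg i 0 b) ∈ wedgeSubgroup ι := by
  rcases le_or_gt 0 b with h | h
  · rw [conjLoop_wedgeSeg_floor i 0 b (by simpa using ⟨h, h₂⟩)]
    exact one_mem _
  · have hn : ⌊b⌋ = -1 := Int.floor_eq_iff.mpr (by push_cast; constructor <;> linarith)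
    have h1 := conjLoop_wedgeSeg_floor i (-1) b (by simp [hn])
    rw [← conjLoop_congr _ (wedgeSeg_trans i 0 (-1) b), conjLoop_trans, h1, one_mul,
      conjLoop_eq_of_forall _ (q := (wedgeLoop i).symm), conjLoop_symm,
      conjLoop_loop wedgeTree_base]
    · exact inv_mem (Subgroup.subset_closure ⟨i, rfl⟩)
    · intro t
      rw [wedgeSeg_apply]
      refine wedgePt_of_turn_eq (turn_eq_turn_iff.mpr ⟨-1, ?_⟩)
      simp [unitInterval.symm]
      ring

theorem conjLoop_mem_of_square {u x y : Wedge ι} (Φ : I × I → Wedge ι) (hΦ : Continuous Φ)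
    (a : Path u x) (p : Path x y) (b : Path u y) (h₀ : ∀ t, Φ (0, t) = u)
    (ha : ∀ s, Φ (s, 0) = a s) (hb : ∀ s, Φ (s, 1) = b s) (hp : ∀ t, Φ (1, t) = p t)
    (ha' : conjLoop wedgeTree a ∈ wedgeSubgroup ι) (hb' : conjLoop wedgeTree b ∈ wedgeSubgroup ι) :
    conjLoop wedgeTree p ∈ wedgeSubgroup ι := by
  have h := conjLoop_congr wedgeTree (trans_homotopic_of_square Φ hΦ a p b h₀ ha hb hp)
  rw [conjLoop_trans] at h
  rw [← h] at hb'
  exact (Subgroup.mul_mem_cancel_right _ ha').mp hb'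

theorem conjLoop_wedgeRadius_mem [Nonempty ι] (z : Wedge ι) :
    conjLoop wedgeTree (wedgeRadius z) ∈ wedgeSubgroup ι := by
  obtain ⟨i, hi⟩ := exists_wedge_index z
  have hm := signedPhase_mem (z.1 i)
  rw [conjLoop_eq_of_forall _ (q := wedgeSeg i 0 (signedPhase (z.1 i)))]
  · exact conjLoop_wedgeSeg_mem i _ (by linarith [hm.1]) (by linarith [hm.2])
  · intro t
    rw [wedgeSeg_apply]
    exact eq_wedgePt (by simp [wedgeRadius_apply]) fun j hj => by simp [wedgeRadius_apply, hi j hj]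

/-- The path on the circle number `i` from the point opposite to the common point to `z`. -/
def wedgeOpp (i : ι) (z : Wedge ι) (hz : z.1 i ≠ 1) : Path (wedgePt i (1 / 2)) z where
  toFun t := wedgePt i (1 / 2 + t * signedPhase (z.1 i * turn (1 / 2)))
  continuous_toFun := by fun_prop
  source' := by simp
  target' := by
    refine (eq_wedgePt ?_ (wedge_coord_eq_one hz)).symm
    have : turn (1 / 2) * turn (1 / 2) = 1 := by
      rw [← turn_add]; norm_num; simpa using turn_intCast 1
    simp only [Set.Icc.coe_one, one_mul, turn_add, turn_signedPhase]
    rw [mul_left_comm, this, mul_one]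

/-- The angle is measured from the opposite point, and `z.1 i ≠ 1` keeps the endpoint strictly below
a full turn. The path is then the quotient of two segments that start at `0`. -/
theorem conjLoop_wedgeOpp_mem (i : ι) (z : Wedge ι) (hz : z.1 i ≠ 1) :
    conjLoop wedgeTree (wedgeOpp i z hz) ∈ wedgeSubgroup ι := by
  have hm := signedPhase_mem (z.1 i * turn (1 / 2))
  have hne : signedPhase (z.1 i * turn (1 / 2)) ≠ 1 / 2 := fun h => by
    have := turn_signedPhase (z.1 i * turn (1 / 2))
    rw [h] at this
    exact hz (by simpa using this.symm)
  have hlt := lt_of_le_of_ne hm.2 hne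
  rw [conjLoop_eq_of_forall _ (q := wedgeSeg i (1 / 2)
    (1 / 2 + signedPhase (z.1 i * turn (1 / 2))))]
  · have h := conjLoop_congr wedgeTree
      (wedgeSeg_trans i 0 (1 / 2) (1 / 2 + signedPhase (z.1 i * turn (1 / 2))))
    rw [conjLoop_trans] at h
    have h1 := conjLoop_wedgeSeg_mem i (1 / 2 + signedPhase (z.1 i * turn (1 / 2)))
      (by linarith [hm.1]) (by linarith)
    rw [← h] at h1
    exact (Subgroup.mul_mem_cancel_right _
      (conjLoop_wedgeSeg_mem i (1 / 2) (by norm_num) (by norm_num))).mp h1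
  · intro t
    rw [wedgeSeg_apply, add_sub_cancel_left]
    rfl

/-- The fundamental group of the one-point union of circles is generated by the circles. -/
theorem wedgeSubgroup_eq_top [Finite ι] [Nonempty ι] : wedgeSubgroup ι = ⊤ := by
  refine eq_top_of_locally_conjLoop_mem wedgeTree_base _ fun z => ?_
  have hc (i : ι) : Continuous fun z : Wedge ι => z.1 i :=
    (continuous_apply i).comp continuous_subtype_val
  -- Two kinds of neighbourhood suffice, each contracted radially to its centre: an open edge,
  -- centred at its midpoint, and the complement of all midpoints, centred at the common point. The
  -- contraction sweeps out a square over any path inside, so only the radii need checking.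
  by_cases hz : ∃ i, z.1 i = turn (1 / 2)
  · obtain ⟨i, hi⟩ := hz
    refine ⟨{z | z.1 i ≠ 1}, (isOpen_ne.preimage (hc i)).mem_nhds ?_, fun x y p hp => ?_⟩
    · intro h
      obtain ⟨n, hn⟩ := turn_eq_one_iff.mp (hi.symm.trans h)
      have : (1 : ℝ) = ((2 * n : ℤ) : ℝ) := by push_cast; linarith
      have : (1 : ℤ) = 2 * n := by exact_mod_cast this
      omega
    have hp' (t : I) : (p t).1 i ≠ 1 := hp ⟨t, rfl⟩
    have hx : x.1 i ≠ 1 := by simpa using hp' 0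
    have hy : y.1 i ≠ 1 := by simpa using hp' 1
    refine conjLoop_mem_of_square
      (fun q => wedgePt i (1 / 2 + q.1 * signedPhase ((p q.2).1 i * turn (1 / 2)))) ?_
      (wedgeOpp i x hx) p (wedgeOpp i y hy) ?_ ?_ ?_ ?_ (conjLoop_wedgeOpp_mem i x hx)
      (conjLoop_wedgeOpp_mem i y hy)
    · refine (continuous_wedgePt i).comp (continuous_const.add
        ((continuous_subtype_val.comp continuous_fst).mul ?_))
      refine continuous_iff_continuousAt.mpr fun q => ?_
      refine ContinuousAt.comp (g := signedPhase)
        (f := fun q : I × I => (p q.2).1 i * turn (1 / 2)) ?_ ?_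
      · exact continuousAt_signedPhase fun h => hp' q.2 (by simpa using h)
      · exact (((hc i).comp (p.continuous.comp continuous_snd)).mul
          continuous_const).continuousAt
    · intro t; simp
    · intro s; simp [wedgeOpp]
    · intro s; simp [wedgeOpp]
    · intro t
      simpa only [wedgeOpp, Path.coe_mk_mk] using (wedgeOpp i (p t) (hp' t)).target
  · push Not at hz
    refine ⟨{z | ∀ i, z.1 i ≠ turn (1 / 2)}, ?_, fun x y p hp => ?_⟩
    · refine IsOpen.mem_nhds ?_ hz
      rw [Set.ofPred_forall]
      exact isOpen_iInter_of_finite fun i => isOpen_ne.preimage (hc i)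
    have hp' (t : I) (i : ι) : (p t).1 i ≠ turn (1 / 2) := hp ⟨t, rfl⟩ i
    refine conjLoop_mem_of_square (fun q => wedgeRadius (p q.2) q.1) ?_
      (wedgeRadius x) p (wedgeRadius y) ?_ ?_ ?_ ?_ (conjLoop_wedgeRadius_mem x)
      (conjLoop_wedgeRadius_mem y)
    · refine (continuous_pi fun i => ?_).subtype_mk _
      refine continuous_turn.comp ((continuous_subtype_val.comp continuous_fst).mul ?_)
      refine continuous_iff_continuousAt.mpr fun q => ?_
      exact ContinuousAt.comp (g := signedPhase) (f := fun q : I × I => (p q.2).1 i)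
        (continuousAt_signedPhase (hp' q.2 i))
        ((hc i).comp (p.continuous.comp continuous_snd)).continuousAt
    · intro t; simp
    · exact fun s => Subtype.ext (funext fun i => by simp only [wedgeRadius_apply, p.source])
    · exact fun s => Subtype.ext (funext fun i => by simp only [wedgeRadius_apply, p.target])
    · intro t; simp

end Wedge

/-! ### Coverings of the one-point union of circles -/

section WedgeCovering

open scoped unitInterval Topology

theorem circle_im_ne_zero {w : Circle} (h₁ : w ≠ 1) (h₂ : w ≠ turn (1 / 2)) : (w : ℂ).im ≠ 0 := by
  intro h
  have hn := Circle.normSq_coe w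
  rw [Complex.normSq_apply, h, mul_zero, add_zero] at hn
  rcases mul_self_eq_one_iff.mp hn with hr | hr
  · exact h₁ (Subtype.ext (Complex.ext hr h))
  · refine h₂ (Subtype.ext (Complex.ext ?_ ?_))
    · rw [hr, coe_turn_half]; simp
    · rw [h, coe_turn_half]; simp

variable {ι Q : Type} (u : ι → Equiv.Perm Q)

/-- The change of coordinates on the circle number `i` from a neighbourhood of the common point. -/
def wedgeTwist (i : ι) (z : Wedge ι) : Equiv.Perm Q :=
  open Classical in if 0 < (z.1 i : ℂ).im then 1 else (u i)⁻¹

theorem continuous_wedge_im (i : ι) : Continuous fun z : Wedge ι => (z.1 i : ℂ).im :=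
  Complex.continuous_im.comp
    (continuous_subtype_val.comp ((continuous_apply i).comp continuous_subtype_val))

/-- The overlap of the two charts consists of two open half circles, told apart by the sign of the
imaginary part. -/
theorem eventually_wedgeTwist_eq {i : ι} {z : Wedge ι} (h₁ : z.1 i ≠ 1)
    (h₂ : z.1 i ≠ turn (1 / 2)) : ∀ᶠ y in 𝓝 z, wedgeTwist u i y = wedgeTwist u i z := by
  have hc := (continuous_wedge_im (ι := ι) i).continuousAt (x := z)
  rcases lt_or_gt_of_ne (circle_im_ne_zero h₁ h₂) with h | h
  · filter_upwards [hc.eventually_lt_const h] with y hy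
    simp [wedgeTwist, hy.not_gt, h.not_gt]
  · filter_upwards [hc.eventually_const_lt h] with y hy
    simp [wedgeTwist, hy, h]

/-- The domains of the charts: the complement of the midpoints of the circles, and the open
edges. -/
def wedgeChart : Option ι → Set (Wedge ι)
  | none => {z | ∀ i, z.1 i ≠ turn (1 / 2)}
  | some i => {z | z.1 i ≠ 1}

theorem turn_half_ne_one : turn (1 / 2) ≠ 1 := by
  intro h
  have h' := congrArg (fun w : Circle => (w : ℂ).re) h
  simp only [coe_turn_half] at h'
  norm_num at h'

theorem exists_mem_wedgeChart (z : Wedge ι) : ∃ k, z ∈ wedgeChart k := by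
  by_cases h : ∀ i, z.1 i ≠ turn (1 / 2)
  · exact ⟨none, h⟩
  · push Not at h
    obtain ⟨i, hi⟩ := h
    exact ⟨some i, by rw [wedgeChart, Set.mem_ofPred_eq, hi]; exact turn_half_ne_one⟩

/-- Distinct open edges are disjoint, so the cocycle condition involves only one edge at a time. -/
theorem eq_of_mem_wedgeChart {z : Wedge ι} {i j : ι} (hi : z ∈ wedgeChart (some i))
    (hj : z ∈ wedgeChart (some j)) : i = j := by
  by_contra h
  rcases z.2 i j h with h | h
  · exact hi h
  · exact hj h

/-- The transition functions. -/
def wedgeCoordChange : Option ι → Option ι → Wedge ι → Equiv.Perm Q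
  | none, none, _ => 1
  | none, some i, z => wedgeTwist u i z
  | some i, none, z => (wedgeTwist u i z)⁻¹
  | some _, some _, _ => 1

theorem eventually_wedgeCoordChange_eq (k l : Option ι) {z : Wedge ι} (hk : z ∈ wedgeChart k)
    (hl : z ∈ wedgeChart l) :
    ∀ᶠ y in 𝓝 z, wedgeCoordChange u k l y = wedgeCoordChange u k l z := by
  rcases k with _ | i <;> rcases l with _ | j
  · exact Filter.Eventually.of_forall fun _ => rfl
  · exact eventually_wedgeTwist_eq u hl (hk j)
  · filter_upwards [eventually_wedgeTwist_eq u hk (hl i)] with y hy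
    simp only [wedgeCoordChange, hy]
  · exact Filter.Eventually.of_forall fun _ => rfl

theorem wedgeCoordChange_mul (k l m : Option ι) {z : Wedge ι} (hk : z ∈ wedgeChart k)
    (hl : z ∈ wedgeChart l) (hm : z ∈ wedgeChart m) :
    wedgeCoordChange u l m z * wedgeCoordChange u k l z = wedgeCoordChange u k m z := by
  rcases k with _ | i <;> rcases l with _ | j <;> rcases m with _ | n <;>
    simp only [wedgeCoordChange, mul_one, one_mul, inv_mul_cancel]
  · rw [eq_of_mem_wedgeChart hl hm]
  · rw [eq_of_mem_wedgeChart hk hm, mul_inv_cancel]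
  · rw [eq_of_mem_wedgeChart hk hl]

variable [Finite ι] [TopologicalSpace Q] [DiscreteTopology Q]

/-- The covering of the one-point union of circles with fibre `Q` in which the circle number `i`
acts on the fibre by `u i`. -/
def wedgeCovering : FiberBundleCore (Option ι) (Wedge ι) Q where
  baseSet := wedgeChart
  isOpen_baseSet k := by
    have hc (i : ι) : Continuous fun z : Wedge ι => z.1 i :=
      (continuous_apply i).comp continuous_subtype_val
    rcases k with _ | i
    · rw [wedgeChart, Set.ofPred_forall]
      exact isOpen_iInter_of_finite fun i => isOpen_ne.preimage (hc i)
    · exact isOpen_ne.preimage (hc i)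
  indexAt z := (exists_mem_wedgeChart z).choose
  mem_baseSet_at z := (exists_mem_wedgeChart z).choose_spec
  coordChange k l z v := wedgeCoordChange u k l z v
  coordChange_self k z _ v := by rcases k with _ | i <;> rfl
  continuousOn_coordChange k l := by
    rintro ⟨z, v⟩ ⟨hz, -⟩
    refine ContinuousAt.continuousWithinAt ?_
    have h := (eventually_wedgeCoordChange_eq u k l hz.1 hz.2)
    have hc : ContinuousAt (fun p : Wedge ι × Q => wedgeCoordChange u k l z p.2) (z, v) :=
      (continuous_of_discreteTopology.comp continuous_snd).continuousAt
    refine hc.congr ?_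
    filter_upwards [continuousAt_fst.eventually h] with p hp
    rw [hp]
  coordChange_comp k l m z hz v := by
    rw [← Equiv.Perm.mul_apply, wedgeCoordChange_mul u k l m hz.1.1 hz.1.2 hz.2]

theorem isCoveringMap_wedgeCovering : IsCoveringMap (wedgeCovering u).proj :=
  FiberBundle.isCoveringMap (F := Q) (E := (wedgeCovering u).Fiber)

/-- The coordinate of a point of the covering in the chart number `k`. -/
def wedgeCoord (k : Option ι) (e : (wedgeCovering u).TotalSpace) : Q :=
  ((wedgeCovering u).localTriv k e).2

theorem continuousOn_wedgeCoord (k : Option ι) :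
    ContinuousOn (wedgeCoord u k) ((wedgeCovering u).proj ⁻¹' wedgeChart k) :=
  continuous_snd.comp_continuousOn ((wedgeCovering u).localTriv k).continuousOn

theorem wedgeCoord_change (k l : Option ι) (e : (wedgeCovering u).TotalSpace)
    (hk : e.1 ∈ wedgeChart k) (hl : e.1 ∈ wedgeChart l) :
    wedgeCoord u l e = wedgeCoordChange u k l e.1 (wedgeCoord u k e) :=
  ((wedgeCovering u).coordChange_comp _ k l e.1
    ⟨⟨(wedgeCovering u).mem_baseSet_at e.1, hk⟩, hl⟩ e.2).symm

theorem exists_wedgeCoord_eq (k : Option ι) (z : Wedge ι) (hz : z ∈ wedgeChart k) (v : Q) :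
    ∃ e : (wedgeCovering u).proj ⁻¹' {z}, wedgeCoord u k e.1 = v := by
  refine ⟨⟨((wedgeCovering u).localTriv k).toOpenPartialHomeomorph.symm (z, v),
    ((wedgeCovering u).localTriv k).proj_symm_apply' hz⟩, ?_⟩
  exact congrArg Prod.snd (((wedgeCovering u).localTriv k).apply_symm_apply' hz)

variable [DecidableEq ι]

/-- Along a lift, the coordinate in a chart is constant while the loop stays in that chart. The loop
enters the open edge through the upper half circle, with trivial transition, and leaves it through
the lower one, which contributes `u i`. The charts are compared at times `1/4` and `3/4`. -/
theorem wedgeCoord_monodromy (i : ι) (e : (wedgeCovering u).proj ⁻¹' {wedgeBase ι}) :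
    wedgeCoord u none ((isCoveringMap_wedgeCovering u).monodromyPerm (wedgeBase ι)
      (FundamentalGroup.fromPath (Path.Homotopic.Quotient.mk (wedgeLoop i))) e).1 =
      u i (wedgeCoord u none e.1) := by
  have cov := isCoveringMap_wedgeCovering u
  have he : (wedgeLoop i) 0 = (wedgeCovering u).proj e.1 := (wedgeLoop i).source.trans e.2.symm
  set Γ := cov.liftPath (wedgeLoop i) e.1 he with hΓ
  have hlift (t : I) : (Γ t).1 = wedgePt i t := congrFun (cov.liftPath_lifts _ _ he) t
  have h0 : Γ 0 = e.1 := cov.liftPath_zero _ _ he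
  change wedgeCoord u none (Γ 1) = _
  rw [← h0]
  have hconst (k : Option ι) (s : Set I) (hs : s.OrdConnected)
      (hk : ∀ t ∈ s, wedgePt i t ∈ wedgeChart k) (a b : I) (ha : a ∈ s) (hb : b ∈ s) :
      wedgeCoord u k (Γ a) = wedgeCoord u k (Γ b) := by
    refine hs.isPreconnected.constant (f := fun t => wedgeCoord u k (Γ t)) ?_ ha hb
    refine (continuousOn_wedgeCoord u k).comp Γ.continuous.continuousOn fun t ht => ?_
    change (Γ t).1 ∈ wedgeChart k
    rw [hlift]
    exact hk t ht
  let q : I := ⟨1 / 4, by norm_num, by norm_num⟩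
  let r : I := ⟨3 / 4, by norm_num, by norm_num⟩
  have hnone (t : I) (ht : (t : ℝ) ≠ 1 / 2) : wedgePt i t ∈ wedgeChart none := by
    intro j
    by_cases hj : j = i
    · subst hj
      simp only [wedgePt, Pi.mulSingle_eq_same]
      intro h
      obtain ⟨n, hn⟩ := turn_eq_turn_iff.mp h
      have h1 : (-1 : ℝ) < n := by linarith [t.2.1]
      have h2 : (n : ℝ) < 1 := by linarith [t.2.2]
      have h1' : -1 < n := by exact_mod_cast h1
      have h2' : n < 1 := by exact_mod_cast h2
      obtain rfl : n = 0 := by omega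
      exact ht (by simpa using hn)
    · simpa [wedgePt, hj] using turn_half_ne_one.symm
  have hsome (t : I) (h₀ : 0 < (t : ℝ)) (h₁ : (t : ℝ) < 1) :
      wedgePt i t ∈ wedgeChart (some i) := by
    simp only [wedgeChart, Set.mem_ofPred_eq, wedgePt, Pi.mulSingle_eq_same]
    intro h
    obtain ⟨n, hn⟩ := turn_eq_one_iff.mp h
    rw [hn] at h₀ h₁
    have h1' : 0 < n := by exact_mod_cast h₀
    have h2' : n < 1 := by exact_mod_cast h₁
    omega
  have him (t : I) : ((wedgePt i t).1 i : ℂ).im = Real.sin (2 * Real.pi * t) := by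
    simp only [wedgePt, Pi.mulSingle_eq_same, turn, Circle.coe_exp, Complex.exp_ofReal_mul_I_im]
  have e1 : wedgeCoord u none (Γ 0) = wedgeCoord u none (Γ q) :=
    hconst none {t | (t : ℝ) < 1 / 2} ⟨fun _ _ _ hb _ hc => lt_of_le_of_lt (Subtype.coe_le_coe.mpr hc.2) hb⟩
      (fun t ht => hnone t (ne_of_lt ht)) 0 q (by simp) (by simp [q]; norm_num)
  have e2 : wedgeCoord u none (Γ r) = wedgeCoord u none (Γ 1) :=
    hconst none {t | 1 / 2 < (t : ℝ)} ⟨fun _ ha _ _ _ hc => lt_of_lt_of_le ha (Subtype.coe_le_coe.mpr hc.1)⟩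
      (fun t ht => hnone t (ne_of_gt ht)) r 1 (by simp [r]; norm_num) (by simp; norm_num)
  have e3 : wedgeCoord u (some i) (Γ q) = wedgeCoord u (some i) (Γ r) :=
    hconst (some i) {t | 0 < (t : ℝ) ∧ (t : ℝ) < 1}
      ⟨fun _ ha _ hb _ hc => ⟨lt_of_lt_of_le ha.1 hc.1, lt_of_le_of_lt hc.2 hb.2⟩⟩
      (fun t ht => hsome t ht.1 ht.2) q r
      (show (0 : ℝ) < 1 / 4 ∧ (1 / 4 : ℝ) < 1 by norm_num)
      (show (0 : ℝ) < 3 / 4 ∧ (3 / 4 : ℝ) < 1 by norm_num)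
  have e4 : wedgeCoord u (some i) (Γ q) = wedgeCoord u none (Γ q) := by
    rw [wedgeCoord_change u none (some i)]
    · have : 0 < ((Γ q).1.1 i : ℂ).im := by
        rw [hlift, him, show 2 * Real.pi * (q : ℝ) = Real.pi / 2 by simp only [q]; ring,
          Real.sin_pi_div_two]
        exact one_pos
      simp [wedgeCoordChange, wedgeTwist, this]
    · rw [hlift]; exact hnone q (by simp only [q]; norm_num)
    · rw [hlift]; exact hsome q (by simp only [q]; norm_num) (by simp only [q]; norm_num)
  have e5 : wedgeCoord u (some i) (Γ r) = (u i)⁻¹ (wedgeCoord u none (Γ r)) := by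
    rw [wedgeCoord_change u none (some i)]
    · have : ¬ 0 < ((Γ r).1.1 i : ℂ).im := by
        rw [hlift, him, show 2 * Real.pi * (r : ℝ) = Real.pi / 2 + Real.pi by simp only [r]; ring,
          Real.sin_add_pi, Real.sin_pi_div_two]
        norm_num
      simp [wedgeCoordChange, wedgeTwist, this]
    · rw [hlift]; exact hnone r (by simp only [r]; norm_num)
    · rw [hlift]; exact hsome r (by simp only [r]; norm_num) (by simp only [r]; norm_num)
  rw [e1, ← e4, e3, e5, e2]
  simp

/-- The circles are free generators of the fundamental group of their one-point union. -/
theorem wedge_lift_injective : Function.Injective (FreeGroup.lift fun i : ι =>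
    FundamentalGroup.fromPath (Path.Homotopic.Quotient.mk (wedgeLoop i))) := by
  let _ : TopologicalSpace (FreeGroup ι) := ⊥
  have : DiscreteTopology (FreeGroup ι) := ⟨rfl⟩
  -- With left translations as monodromy, the image of a word `w` moves the point with coordinate
  -- `1` to the one with coordinate `w`; a word in the kernel must therefore be trivial.
  let u : ι → Equiv.Perm (FreeGroup ι) := fun i => Equiv.mulLeft (FreeGroup.of i)
  have key (w : FreeGroup ι) : ∀ e : (wedgeCovering u).proj ⁻¹' {wedgeBase ι},
      wedgeCoord u none ((isCoveringMap_wedgeCovering u).monodromyPerm (wedgeBase ι)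
      (FreeGroup.lift (fun i : ι =>
        FundamentalGroup.fromPath (Path.Homotopic.Quotient.mk (wedgeLoop i))) w) e).1 =
      w * (wedgeCoord u none e.1) := by
    induction w using FreeGroup.induction_on with
    | C1 =>
      intro e
      rw [map_one, map_one, one_mul]
      rfl
    | of i =>
      intro e
      simp only [FreeGroup.lift_apply_of]
      rw [wedgeCoord_monodromy]
      rfl
    | inv_of i h =>
      intro e
      rw [eq_inv_mul_iff_mul_eq, ← h, map_inv, map_inv, ← Equiv.Perm.mul_apply, mul_inv_cancel]
      rfl
    | mul x y hx hy =>
      intro e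
      rw [map_mul, map_mul, Equiv.Perm.mul_apply, hx, hy, mul_assoc]
  rw [injective_iff_map_eq_one]
  intro w hw
  obtain ⟨e, he⟩ := exists_wedgeCoord_eq u none (wedgeBase ι) (fun _ => turn_half_ne_one.symm) 1
  have h := key w e
  rw [hw, map_one, he, mul_one] at h
  rw [← h, ← he]
  rfl

end WedgeCovering

/-! ### The surface retracts onto the one-point union of the side loops -/

section Retraction

open scoped unitInterval Topology

/-- The point of the polygon at position `s` along its boundary. -/
def circlePt (g : ℕ) (s : ℝ) : Disc :=
  ⟨turn (s / (4 * g + 1)), by rw [mem_closedBall_zero_iff, Circle.norm_coe]⟩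

theorem sidePoint_eq (g k : ℕ) (t : I) : sidePoint g k t = circlePt g (k + t) := rfl

@[fun_prop]
theorem continuous_circlePt (g : ℕ) : Continuous (circlePt g) := by unfold circlePt; fun_prop

/-- The free side is left out, so the glued sides form an arc of less than a full turn. -/
theorem circlePt_injOn (g : ℕ) : Set.InjOn (circlePt g) (Set.Icc 0 (4 * g)) := by
  intro s hs s' hs' h
  have hpos : (0 : ℝ) < 4 * g + 1 := by positivity
  have h' : turn (s / (4 * g + 1)) = turn (s' / (4 * g + 1)) :=
    Subtype.val_injective (congrArg (fun z : Disc => (z : ℂ)) h)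
  obtain ⟨n, hn⟩ := turn_eq_turn_iff.mp h'
  rw [div_eq_iff hpos.ne', add_mul, div_mul_cancel₀ _ hpos.ne'] at hn
  have h1 : (n : ℝ) < 1 := by
    by_contra hc
    nlinarith [hs.1, hs.2, hs'.1, hs'.2]
  have h2 : (-1 : ℝ) < n := by
    by_contra hc
    nlinarith [hs.1, hs.2, hs'.1, hs'.2]
  have h1' : n < 1 := by exact_mod_cast h1
  have h2' : -1 < n := by exact_mod_cast h2
  obtain rfl : n = 0 := by omega
  simpa using hn

/-- The glued sides form a closed arc, and Tietze's theorem extends its position parameter to the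
disc with values in the same interval. -/
theorem exists_discRetraction (g : ℕ) : ∃ q : C(Disc, ℝ), (∀ z, q z ∈ Set.Icc (0 : ℝ) (4 * g)) ∧
    ∀ s ∈ Set.Icc (0 : ℝ) (4 * g), q (circlePt g s) = s := by
  let e : Set.Icc (0 : ℝ) (4 * g) → Disc := fun s => circlePt g s
  have he : Topology.IsClosedEmbedding e :=
    Continuous.isClosedEmbedding (by fun_prop) fun s s' h => Subtype.ext
      (circlePt_injOn g s.2 s'.2 h)
  obtain ⟨q, hq, hqe⟩ := ContinuousMap.exists_extension_forall_mem_of_isClosedEmbedding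
    (⟨Subtype.val, continuous_subtype_val⟩ : C(Set.Icc (0 : ℝ) (4 * g), ℝ))
    (t := Set.Icc (0 : ℝ) (4 * g)) (fun s => s.2) (Set.nonempty_Icc.mpr (by positivity)) he
  exact ⟨q, hq, fun s hs => congrFun hqe ⟨s, hs⟩⟩

/-- A retraction of the polygon onto its glued sides, given by the position on the boundary. -/
def discRetraction (g : ℕ) : C(Disc, ℝ) := (exists_discRetraction g).choose

theorem discRetraction_mem (g : ℕ) (z : Disc) : discRetraction g z ∈ Set.Icc (0 : ℝ) (4 * g) :=
  (exists_discRetraction g).choose_spec.1 z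

theorem discRetraction_circlePt (g : ℕ) {s : ℝ} (hs : s ∈ Set.Icc (0 : ℝ) (4 * g)) :
    discRetraction g (circlePt g s) = s :=
  (exists_discRetraction g).choose_spec.2 s hs

theorem discRetraction_sidePoint (g : ℕ) {k : ℕ} (hk : k < 4 * g) (t : I) :
    discRetraction g (sidePoint g k t) = k + t := by
  have hk' : (k : ℝ) + 1 ≤ 4 * g := by exact_mod_cast hk
  exact discRetraction_circlePt g ⟨by linarith [t.2.1, k.cast_nonneg (α := ℝ)],
    by linarith [t.2.2]⟩

/-- The number of the first of the two sides of the polygon that give a generator. -/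
def sideNumber {g : ℕ} : Fin g ⊕ Fin g → ℤ
  | .inl i => 4 * (i : ℕ)
  | .inr i => 4 * (i : ℕ) + 1

theorem sideNumber_unique {g : ℕ} {j j' : Fin g ⊕ Fin g} {k : ℤ}
    (h : k = sideNumber j ∨ k = sideNumber j + 2) (h' : k = sideNumber j' ∨ k = sideNumber j' + 2) :
    j = j' := by
  rcases j with i | i <;> rcases j' with i' | i' <;> simp only [sideNumber] at h h'
  · exact congrArg _ (Fin.ext (by omega))
  · omega
  · omega
  · exact congrArg _ (Fin.ext (by omega))

/-- The position at time `s` on the circle given by the sides `m` and `m + 2`. -/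
def sidePos (m : ℤ) (s : ℝ) : ℝ := max 0 (min 1 (s - m)) - max 0 (min 1 (s - m - 2))

/-- The graph of `sidePos m` is a trapezoid: it rises from `0` to `1` on side `m`, falls back on
side `m + 2`, and is an integer constant elsewhere. This is the gluing with reversed directions, in
one continuous formula. -/
theorem turn_sidePos (m k : ℤ) (t : ℝ) (ht : t ∈ Set.Icc (0 : ℝ) 1) :
    turn (sidePos m (k + t)) = if k = m then turn t else if k = m + 2 then turn (-t) else 1 := by
  obtain ⟨h0, h1⟩ := ht
  unfold sidePos
  rcases lt_trichotomy k m with h | h | h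
  · have h' : (k : ℝ) + 1 ≤ m := by exact_mod_cast h
    rw [if_neg (by omega), if_neg (by omega), min_eq_right (by linarith), max_eq_left (by linarith),
      min_eq_right (by linarith), max_eq_left (by linarith)]
    simp
  · subst h
    rw [if_pos rfl, min_eq_right (by linarith), max_eq_right (by linarith),
      min_eq_right (by linarith), max_eq_left (by linarith)]
    simp
  have h' : (m : ℝ) + 1 ≤ k := by exact_mod_cast h
  rw [min_eq_left (by linarith), max_eq_right (by linarith), if_neg (by omega)]
  rcases lt_trichotomy k (m + 2) with h2 | h2 | h2
  · have h2' : (k : ℝ) + 1 ≤ m + 2 := by exact_mod_cast h2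
    rw [if_neg (by omega), min_eq_right (by linarith), max_eq_left (by linarith)]
    simpa using turn_intCast 1
  · subst h2
    rw [if_pos rfl]
    push_cast
    rw [min_eq_right (by linarith), max_eq_right (by linarith)]
    refine turn_eq_turn_iff.mpr ⟨1, ?_⟩
    push_cast; ring
  · have h2' : (m : ℝ) + 2 + 1 ≤ k := by exact_mod_cast h2
    rw [if_neg (by omega), min_eq_left (by linarith), max_eq_right (by linarith)]
    simp

theorem turn_sidePos_ne_one {m : ℤ} {s : ℝ} (h : turn (sidePos m s) ≠ 1) :
    ⌊s⌋ = m ∨ ⌊s⌋ = m + 2 := by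
  by_contra hc
  push Not at hc
  apply h
  rw [← Int.floor_add_fract s, turn_sidePos _ _ _ ⟨Int.fract_nonneg s, (Int.fract_lt_one s).le⟩,
    if_neg hc.1, if_neg hc.2]

/-- The map from the boundary of the polygon to the one-point union of circles. -/
def edgeMap (g : ℕ) (s : ℝ) : Wedge (Fin g ⊕ Fin g) :=
  ⟨fun j => turn (sidePos (sideNumber j) s), fun j j' hjj' => by
    by_contra hc
    push Not at hc
    exact hjj' (sideNumber_unique (turn_sidePos_ne_one hc.1) (turn_sidePos_ne_one hc.2))⟩

@[fun_prop]
theorem continuous_edgeMap (g : ℕ) : Continuous (edgeMap g) := by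
  unfold edgeMap sidePos
  fun_prop

theorem edgeMap_fst {g : ℕ} (j : Fin g ⊕ Fin g) (s : ℝ) (t : I) (hs : s = sideNumber j + t) :
    edgeMap g s = wedgePt j t := by
  subst hs
  refine eq_wedgePt ?_ fun j' hj' => ?_
  · simp only [edgeMap, turn_sidePos _ _ _ t.2, if_true]
  · simp only [edgeMap, turn_sidePos _ _ _ t.2]
    rw [if_neg fun h => hj' (sideNumber_unique (Or.inl h) (Or.inl rfl)),
      if_neg fun h => hj' (sideNumber_unique (Or.inr h) (Or.inl rfl))]

theorem edgeMap_snd {g : ℕ} (j : Fin g ⊕ Fin g) (s : ℝ) (t : I) (hs : s = sideNumber j + 2 + t) :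
    edgeMap g s = wedgePt j (σ t) := by
  have hs' : s = ((sideNumber j + 2 : ℤ) : ℝ) + t := by rw [hs]; push_cast; ring
  subst hs'
  have hw : turn (-(t : ℝ)) = turn (σ t : I) := turn_eq_turn_iff.mpr ⟨-1, by
    rw [unitInterval.coe_symm_eq]; push_cast; ring⟩
  refine eq_wedgePt ?_ fun j' hj' => ?_
  · simp only [edgeMap, turn_sidePos _ _ _ t.2, if_true]
    rw [if_neg (by omega), hw]
  · simp only [edgeMap, turn_sidePos _ _ _ t.2]
    rw [if_neg fun h => hj' (sideNumber_unique (Or.inl h) (Or.inr rfl)),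
      if_neg fun h => hj' (sideNumber_unique (Or.inr h) (Or.inr rfl))]

/-- The side loops. -/
def genLoop {g : ℕ} : Fin g ⊕ Fin g → Path (basept g) (basept g) :=
  Sum.elim (alphaLoop g) (betaLoop g)

theorem sideRel_lt {g : ℕ} {z w : Disc} (h : SideRel g z w) :
    (∃ k < 4 * g, ∃ t, z = sidePoint g k t) ∧ (∃ k < 4 * g, ∃ t, w = sidePoint g k t) := by
  cases h with
  | alpha i t => exact ⟨⟨_, by omega, _, rfl⟩, ⟨_, by omega, _, rfl⟩⟩
  | beta i t => exact ⟨⟨_, by omega, _, rfl⟩, ⟨_, by omega, _, rfl⟩⟩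

theorem edgeMap_discRetraction_eq {g : ℕ} {z w : Disc} (h : SideRel g z w) :
    edgeMap g (discRetraction g z) = edgeMap g (discRetraction g w) := by
  cases h with
  | alpha i t =>
    rw [discRetraction_sidePoint g (by omega), discRetraction_sidePoint g (by omega),
      edgeMap_fst (.inl i) _ t (by simp [sideNumber]),
      edgeMap_snd (.inl i) _ (σ t) (by simp [sideNumber]), unitInterval.symm_symm]
  | beta i t =>
    rw [discRetraction_sidePoint g (by omega), discRetraction_sidePoint g (by omega),
      edgeMap_fst (.inr i) _ t (by simp [sideNumber]),
      edgeMap_snd (.inr i) _ (σ t) (by simp [sideNumber]; ring), unitInterval.symm_symm]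

/-- The retraction of the surface onto the one-point union of the side loops. -/
def toWedge (g : ℕ) : C(Surface g, Wedge (Fin g ⊕ Fin g)) where
  toFun := Quot.lift (fun z => edgeMap g (discRetraction g z)) fun _ _ => edgeMap_discRetraction_eq
  continuous_toFun := continuous_quot_lift _ (by fun_prop)

theorem toWedge_toSurface (g : ℕ) (z : Disc) :
    toWedge g (toSurface g z) = edgeMap g (discRetraction g z) := rfl

theorem toWedge_genLoop {g : ℕ} (j : Fin g ⊕ Fin g) (t : I) :
    toWedge g (genLoop j t) = wedgeLoop j t := by
  rcases j with i | i
  · change toWedge g (toSurface g (sidePoint g (4 * i) t)) = wedgePt (.inl i) t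
    rw [toWedge_toSurface, discRetraction_sidePoint g (by omega),
      edgeMap_fst (.inl i) _ t (by simp [sideNumber])]
  · change toWedge g (toSurface g (sidePoint g (4 * i + 1) t)) = wedgePt (.inr i) t
    rw [toWedge_toSurface, discRetraction_sidePoint g (by omega),
      edgeMap_fst (.inr i) _ t (by simp [sideNumber])]

theorem toWedge_basept {g : ℕ} (hg : 1 ≤ g) : toWedge g (basept g) = wedgeBase (Fin g ⊕ Fin g) := by
  have h := toWedge_genLoop (g := g) (.inl ⟨0, hg⟩) 0
  rwa [Path.source, Path.source] at h

/-- The one-point union is a quotient of disjoint intervals, being a Hausdorff image of a compact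
space. Only endpoints get identified, and the side loops send them all to the basepoint. -/
theorem exists_ofWedge {g : ℕ} (hg : 1 ≤ g) : ∃ f : C(Wedge (Fin g ⊕ Fin g), Surface g),
    ∀ j (t : I), f (wedgePt j t) = genLoop j t := by
  let c : (Fin g ⊕ Fin g) × I → Wedge (Fin g ⊕ Fin g) := fun x => wedgePt x.1 x.2
  have hc : Continuous c := continuous_prod_of_discrete_left.mpr fun j => by
    change Continuous fun t : I => wedgePt j t
    fun_prop
  have hne : Nonempty (Fin g ⊕ Fin g) := ⟨.inl ⟨0, hg⟩⟩
  have hsurj : Function.Surjective c := fun z => by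
    obtain ⟨j, hj⟩ := exists_wedge_index z
    exact ⟨(j, ⟨phase (z.1 j), Int.fract_nonneg _, (Int.fract_lt_one _).le⟩),
      (eq_wedgePt (turn_phase _).symm hj).symm⟩
  have hq : Topology.IsQuotientMap (⟨c, hc⟩ : C(_, _)) := .of_surjective_continuous hsurj hc
  let f : C((Fin g ⊕ Fin g) × I, Surface g) := ⟨fun x => genLoop x.1 x.2,
    continuous_prod_of_discrete_left.mpr fun j => (genLoop j).continuous⟩
  have hends (j : Fin g ⊕ Fin g) (t : I) (h : turn t = 1) : genLoop j t = basept g := by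
    obtain ⟨n, hn⟩ := turn_eq_one_iff.mp h
    have h0 : (0 : ℝ) ≤ n := hn ▸ t.2.1
    have h1 : (n : ℝ) ≤ 1 := hn ▸ t.2.2
    have h0' : 0 ≤ n := by exact_mod_cast h0
    have h1' : n ≤ 1 := by exact_mod_cast h1
    obtain rfl | rfl : n = 0 ∨ n = 1 := by omega
    · obtain rfl : t = 0 := Subtype.ext (by simpa using hn)
      exact Path.source _
    · obtain rfl : t = 1 := Subtype.ext (by simpa using hn)
      exact Path.target _
  have hf : Function.FactorsThrough f c := by
    rintro ⟨j, t⟩ ⟨j', t'⟩ h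
    change genLoop j t = genLoop j' t'
    have hj : turn t = (wedgePt j' t').1 j := by
      rw [← show c (j, t) = wedgePt j' t' from h]; simp [c, wedgePt]
    have hj' : turn t' = (wedgePt j t).1 j' := by
      rw [show wedgePt j t = c (j', t') from h]; simp [c, wedgePt]
    by_cases hjj : j = j'
    · subst hjj
      by_cases h1 : turn t = 1
      · have h1' : turn t' = 1 := by rw [hj']; simpa [wedgePt] using h1
        rw [hends j t h1, hends j t' h1']
      · have h2 : turn t = turn t' := by rw [hj]; simp [wedgePt]
        obtain ⟨n, hn⟩ := turn_eq_turn_iff.mp h2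
        have hlt (a : I) (ha : turn a ≠ 1) : 0 < (a : ℝ) ∧ (a : ℝ) < 1 := by
          refine ⟨lt_of_le_of_ne a.2.1 fun h => ha ?_, lt_of_le_of_ne a.2.2 fun h => ha ?_⟩
          · rw [← h, turn_zero]
          · rw [h]; simpa using turn_intCast 1
        have ht := hlt t h1
        have ht' := hlt t' (h2 ▸ h1)
        have hn1 : (n : ℝ) < 1 := by linarith
        have hn2 : (-1 : ℝ) < n := by linarith
        have hn1' : n < 1 := by exact_mod_cast hn1
        have hn2' : -1 < n := by exact_mod_cast hn2
        obtain rfl : n = 0 := by omega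
        rw [show t = t' from Subtype.ext (by simpa using hn)]
    · rw [hends j t (by rw [hj]; simp [wedgePt, hjj]),
        hends j' t' (by rw [hj']; simp [wedgePt, Ne.symm hjj])]
  exact ⟨hq.lift f hf, fun j t => DFunLike.congr_fun (hq.lift_comp f hf) (j, t)⟩

/-- The inclusion of the one-point union of the side loops in the surface. -/
def ofWedge {g : ℕ} (hg : 1 ≤ g) : C(Wedge (Fin g ⊕ Fin g), Surface g) := (exists_ofWedge hg).choose

theorem ofWedge_wedgePt {g : ℕ} (hg : 1 ≤ g) (j : Fin g ⊕ Fin g) (t : I) :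
    ofWedge hg (wedgePt j t) = genLoop j t := (exists_ofWedge hg).choose_spec j t

theorem ofWedge_base {g : ℕ} (hg : 1 ≤ g) : ofWedge hg (wedgeBase _) = basept g := by
  have h := ofWedge_wedgePt hg (.inl ⟨0, hg⟩) 0
  rw [Path.source] at h
  rw [← h]
  exact congrArg _ (wedgePt_of_turn_eq_one _ (by simp)).symm

/-- On the glued sides, going to the one-point union and back changes nothing modulo the side
pairing: a second side of a pair returns as the first one. -/
theorem ofWedge_edgeMap {g : ℕ} (hg : 1 ≤ g) {s : ℝ} (hs : s ∈ Set.Icc (0 : ℝ) (4 * g)) :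
    ofWedge hg (edgeMap g s) = toSurface g (circlePt g s) := by
  obtain ⟨k, hk, t, rfl⟩ : ∃ k < 4 * g, ∃ t : I, s = k + t := by
    by_cases h : s = 4 * g
    -- The last position has floor `4 * g`, the free side, so it is taken as the end of side `4 * g
    -- - 1`.
    · refine ⟨4 * g - 1, by omega, 1, ?_⟩
      rw [h]
      push_cast [show 1 ≤ 4 * g by omega]
      simp
    · refine ⟨⌊s⌋₊, ?_, ⟨s - ⌊s⌋₊, ?_, ?_⟩, by simp⟩
      · rw [Nat.floor_lt hs.1]; push_cast; exact lt_of_le_of_ne hs.2 h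
      · linarith [Nat.floor_le hs.1]
      · linarith [Nat.lt_floor_add_one s]
  rw [← sidePoint_eq]
  obtain ⟨i, hi⟩ : ∃ i : Fin g, k = 4 * i ∨ k = 4 * i + 1 ∨ k = 4 * i + 2 ∨ k = 4 * i + 3 :=
    ⟨⟨k / 4, by omega⟩, by simp only; omega⟩
  rcases hi with rfl | rfl | rfl | rfl
  · rw [edgeMap_fst (.inl i) _ t (by simp [sideNumber]), ofWedge_wedgePt]
    rfl
  · rw [edgeMap_fst (.inr i) _ t (by simp [sideNumber]), ofWedge_wedgePt]
    rfl
  · rw [edgeMap_snd (.inl i) _ t (by simp [sideNumber]), ofWedge_wedgePt]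
    have h : toSurface g _ = toSurface g _ := Quot.sound (SideRel.alpha i (σ t))
    rw [unitInterval.symm_symm] at h
    exact h
  · rw [edgeMap_snd (.inr i) _ t (by simp [sideNumber]; ring), ofWedge_wedgePt]
    have h : toSurface g _ = toSurface g _ := Quot.sound (SideRel.beta i (σ t))
    rw [unitInterval.symm_symm] at h
    exact h

/-- The point at time `t` on the segment from `z` to `w` in the disc. -/
def discSeg (z w : Disc) (t : I) : Disc :=
  ⟨(1 - (t : ℝ)) • (z : ℂ) + (t : ℝ) • (w : ℂ), convex_closedBall 0 1 z.2 w.2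
    (by linarith [t.2.2]) t.2.1 (by ring)⟩

theorem discSeg_self (z : Disc) (t : I) : discSeg z z t = z :=
  Subtype.ext (by simp only [discSeg, ← add_smul]; simp)

/-- The deformation of the surface to the one-point union of the side loops. -/
def deform (g : ℕ) (t : I) (x : Surface g) : Surface g :=
  Quot.lift (fun z => toSurface g (discSeg z (circlePt g (discRetraction g z)) t)) (by
    intro z w h
    -- Glued points lie on sides that the retraction fixes, so both segments are constant.
    obtain ⟨⟨k, hk, a, rfl⟩, l, hl, b, rfl⟩ := sideRel_lt h
    simp only [discRetraction_sidePoint g hk, discRetraction_sidePoint g hl, ← sidePoint_eq,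
      discSeg_self]
    exact Quot.sound h) x

theorem continuous_deform (g : ℕ) : Continuous fun p : I × Surface g => deform g p.1 p.2 := by
  refine Topology.IsQuotientMap.continuous_lift_prod_right (f := toSurface g) isQuotientMap_quot_mk ?_
  change Continuous fun p : I × Disc =>
    toSurface g (discSeg p.2 (circlePt g (discRetraction g p.2)) p.1)
  refine (continuous_toSurface g).comp ?_
  unfold discSeg
  fun_prop

theorem deform_zero {g : ℕ} (x : Surface g) : deform g 0 x = x := by
  induction x using Quot.ind with | mk z =>
  change toSurface g _ = toSurface g z
  congr 1
  exact Subtype.ext (by simp [discSeg])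

theorem deform_one {g : ℕ} (hg : 1 ≤ g) (x : Surface g) :
    deform g 1 x = ofWedge hg (toWedge g x) := by
  induction x using Quot.ind with | mk z =>
  change toSurface g _ = ofWedge hg (edgeMap g (discRetraction g z))
  rw [ofWedge_edgeMap hg (discRetraction_mem g z)]
  congr 1
  exact Subtype.ext (by simp [discSeg])

theorem deform_basept {g : ℕ} (hg : 1 ≤ g) (t : I) : deform g t (basept g) = basept g := by
  change toSurface g _ = toSurface g _
  rw [discRetraction_sidePoint g (by omega), ← sidePoint_eq, discSeg_self]

/-! ### Freeness of the fundamental group of the surface -/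

theorem mapOfEq_loop {X Y : Type*} [TopologicalSpace X] [TopologicalSpace Y] (f : C(X, Y)) {x : X}
    {y : Y} (h : f x = y) (p : Path x x) :
    FundamentalGroup.mapOfEq f h (FundamentalGroup.fromPath (.mk p)) =
      FundamentalGroup.fromPath (.mk ((p.map f.continuous).cast h.symm h.symm)) :=
  FundamentalGroup.mapOfEq_apply _ _ _

/-- `deform` is a homotopy from the identity to the composite that keeps the basepoint fixed. -/
theorem mapOfEq_ofWedge_toWedge {g : ℕ} (hg : 1 ≤ g) (x : Pi1 g) :
    FundamentalGroup.mapOfEq (ofWedge hg) (ofWedge_base hg)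
      (FundamentalGroup.mapOfEq (toWedge g) (toWedge_basept hg) x) = x := by
  obtain ⟨p, rfl⟩ := loopClass_surjective x
  rw [loopClass, mapOfEq_loop, mapOfEq_loop]
  refine Quotient.sound (Path.Homotopic.symm ⟨?_⟩)
  exact
    { toFun := fun q => deform g q.1 (p q.2)
      continuous_toFun := (continuous_deform g).comp
        (continuous_fst.prodMk (p.continuous.comp continuous_snd))
      map_zero_left := fun t => deform_zero _
      map_one_left := fun t => deform_one hg _
      prop' := by
        rintro t s (rfl | rfl)
        · simpa using deform_basept hg t
        · simpa using deform_basept hg t }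

theorem mapOfEq_toWedge_gen {g : ℕ} (hg : 1 ≤ g) (j : Fin g ⊕ Fin g) :
    FundamentalGroup.mapOfEq (toWedge g) (toWedge_basept hg) (loopClass (genLoop j)) =
      FundamentalGroup.fromPath (.mk (wedgeLoop j)) := by
  rw [loopClass, mapOfEq_loop]
  congr 2
  exact Path.ext (funext fun t => toWedge_genLoop j t)

theorem mapOfEq_ofWedge_loop {g : ℕ} (hg : 1 ≤ g) (j : Fin g ⊕ Fin g) :
    FundamentalGroup.mapOfEq (ofWedge hg) (ofWedge_base hg)
      (FundamentalGroup.fromPath (.mk (wedgeLoop j))) = loopClass (genLoop j) := by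
  rw [← mapOfEq_toWedge_gen hg, mapOfEq_ofWedge_toWedge]

/-- The fundamental group of the surface is generated by the side loops. -/
theorem closure_genLoop {g : ℕ} (hg : 1 ≤ g) :
    Subgroup.closure (Set.range fun j : Fin g ⊕ Fin g => loopClass (genLoop j)) = ⊤ := by
  have hne : Nonempty (Fin g ⊕ Fin g) := ⟨.inl ⟨0, hg⟩⟩
  refine (Subgroup.eq_top_iff' _).mpr fun x => ?_
  rw [← mapOfEq_ofWedge_toWedge hg x]
  have h : FundamentalGroup.mapOfEq (toWedge g) (toWedge_basept hg) x ∈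
      wedgeSubgroup (Fin g ⊕ Fin g) := by
    rw [wedgeSubgroup_eq_top]; trivial
  have h' := Subgroup.mem_map_of_mem
    (FundamentalGroup.mapOfEq (ofWedge hg) (ofWedge_base hg)) h
  rw [wedgeSubgroup, MonoidHom.map_closure, ← Set.range_comp] at h'
  convert h' using 3
  funext j
  exact (mapOfEq_ofWedge_loop hg j).symm

/-- Injectivity is inherited from the one-point union, since the composite with the map induced by
`toWedge` is injective. Surjectivity is `closure_genLoop`. -/
theorem lift_genLoop_bijective {g : ℕ} (hg : 1 ≤ g) :
    Function.Bijective (FreeGroup.lift fun j : Fin g ⊕ Fin g => loopClass (genLoop j)) := by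
  constructor
  · have h : (FundamentalGroup.mapOfEq (toWedge g) (toWedge_basept hg)).comp
        (FreeGroup.lift fun j : Fin g ⊕ Fin g => loopClass (genLoop j)) =
        FreeGroup.lift fun j => FundamentalGroup.fromPath (.mk (wedgeLoop j)) := by
      ext j
      simpa using mapOfEq_toWedge_gen hg j
    have hi := wedge_lift_injective (ι := Fin g ⊕ Fin g)
    rw [← h, MonoidHom.coe_comp] at hi
    exact hi.of_comp
  · rw [← MonoidHom.range_eq_top, FreeGroup.range_lift_eq_closure, closure_genLoop hg]

/-- The fundamental group of the surface is free on the side loops. -/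
def freeEquiv {g : ℕ} (hg : 1 ≤ g) : FreeGroup (Fin g ⊕ Fin g) ≃* Pi1 g :=
  MulEquiv.ofBijective _ (lift_genLoop_bijective hg)

theorem freeEquiv_of {g : ℕ} (hg : 1 ≤ g) (j : Fin g ⊕ Fin g) :
    freeEquiv hg (FreeGroup.of j) = loopClass (genLoop j) := by
  simp [freeEquiv]

end Retraction

/-! ### The boundary loop -/

section BoundaryLoop

open scoped unitInterval Topology

/-- The class of the image of a path in the polygon between two of its vertices. -/
def discClass {g : ℕ} {z w : Disc} (hz : toSurface g z = basept g) (hw : toSurface g w = basept g)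
    (p : Path z w) : Pi1 g :=
  loopClass ((p.map (continuous_toSurface g)).cast hz.symm hw.symm)

theorem disc_homotopic {z w : Disc} (p q : Path z w) : p.Homotopic q := by
  have : ContractibleSpace Disc :=
    (convex_closedBall (0 : ℂ) 1).contractibleSpace ⟨0, by simp⟩
  exact SimplyConnectedSpace.paths_homotopic p q

theorem discClass_congr {g : ℕ} {z w : Disc} (hz : toSurface g z = basept g)
    (hw : toSurface g w = basept g) (p q : Path z w) : discClass hz hw p = discClass hz hw q :=
  Path.Homotopic.Quotient.eq.mpr
    (((disc_homotopic p q).map ⟨_, continuous_toSurface g⟩).pathCast hz.symm hw.symm)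

theorem discClass_trans {g : ℕ} {z w v : Disc} (hz : toSurface g z = basept g)
    (hw : toSurface g w = basept g) (hv : toSurface g v = basept g) (p : Path z w) (q : Path w v) :
    discClass hz hv (p.trans q) = discClass hw hv q * discClass hz hw p := by
  rw [FundamentalGroup.mul_def]
  simp only [discClass, loopClass, FundamentalGroup.fromPath, FundamentalGroup.fromArrow]
  rw [← Path.Homotopic.Quotient.mk_trans]
  congr 1
  refine Path.ext (funext fun t => ?_)
  simp only [Path.cast_coe, Path.map_coe, Function.comp_apply, Path.trans_apply]
  split_ifs <;> rfl

theorem discClass_refl {g : ℕ} {z : Disc} (hz : toSurface g z = basept g) (p : Path z z) :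
    discClass hz hz p = 1 := by
  rw [discClass_congr hz hz p (Path.refl z)]
  refine congrArg Path.Homotopic.Quotient.mk (Path.ext (funext fun t => ?_))
  exact hz

/-- The path along side number `k` of the polygon. -/
def sidePath (g k : ℕ) : Path (sidePoint g k 0) (sidePoint g (k + 1) 0) where
  toFun := sidePoint g k
  continuous_toFun := continuous_sidePoint g k
  source' := rfl
  target' := sidePoint_one g k

/-- The path along the first `k` sides of the polygon. -/
def sidesPath (g : ℕ) : ∀ k : ℕ, Path (sidePoint g 0 0) (sidePoint g k 0)
  | 0 => Path.refl _
  | k + 1 => (sidesPath g k).trans (sidePath g k)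

theorem toSurface_vertex (g : ℕ) {k : ℕ} (hk : k ≤ 4 * g) :
    toSurface g (sidePoint g k 0) = basept g := by
  rcases hk.eq_or_lt with rfl | hk
  · exact vertex_four_mul g g le_rfl
  obtain ⟨i, hi⟩ : ∃ i : Fin g, k = 4 * i ∨ k = 4 * i + 1 ∨ k = 4 * i + 2 ∨ k = 4 * i + 3 :=
    ⟨⟨k / 4, by omega⟩, by simp only; omega⟩
  rcases hi with rfl | rfl | rfl | rfl
  · exact vertex_alpha_zero g i
  · exact vertex_beta_zero g i
  · rw [← vertex_beta_one g i, sidePoint_one]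
  · rw [← (vertex_step g i).2.2.2, ← vertex_beta_one g i, sidePoint_one]

/-- The class of the path along the first `k` sides of the polygon. -/
def sidesClass (g k : ℕ) (hk : k ≤ 4 * g) : Pi1 g :=
  discClass (toSurface_vertex g (Nat.zero_le _)) (toSurface_vertex g hk) (sidesPath g k)

theorem sidesClass_succ (g k : ℕ) (hk : k + 1 ≤ 4 * g) :
    sidesClass g (k + 1) hk = discClass (toSurface_vertex g (Nat.le_of_succ_le hk))
      (toSurface_vertex g hk) (sidePath g k) * sidesClass g k (Nat.le_of_succ_le hk) :=
  discClass_trans _ _ _ _ _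

theorem loopClass_symm {g : ℕ} (p : Path (basept g) (basept g)) :
    loopClass p.symm = (loopClass p)⁻¹ := rfl

theorem discClass_sidePath_inv {g k : ℕ} (p : Path (basept g) (basept g))
    (hz : toSurface g (sidePoint g k 0) = basept g)
    (hw : toSurface g (sidePoint g (k + 1) 0) = basept g)
    (h : ∀ t, p (σ t) = toSurface g (sidePoint g k t)) :
    discClass hz hw (sidePath g k) = (loopClass p)⁻¹ := by
  rw [← loopClass_symm]
  exact congrArg loopClass (Path.ext (funext fun t => (h t).symm))

/-- The four sides of a handle read `α β α⁻¹ β⁻¹` in order of travel. With the right factor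
travelled first, this is the product `β⁻¹ α⁻¹ β α`. -/
theorem sidesClass_block {g : ℕ} (i : Fin g) :
    sidesClass g (4 * (i + 1)) (by omega) =
      ⁅(loopClass (betaLoop g i))⁻¹, (loopClass (alphaLoop g i))⁻¹⁆ *
        sidesClass g (4 * i) (by omega) := by
  have h3 := sidesClass_succ g (4 * i + 3) (by omega)
  have h2 := sidesClass_succ g (4 * i + 2) (by omega)
  have h1 := sidesClass_succ g (4 * i + 1) (by omega)
  have h0 := sidesClass_succ g (4 * i) (by omega)
  rw [discClass_sidePath_inv (betaLoop g i)] at h3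
  · rw [discClass_sidePath_inv (alphaLoop g i)] at h2
    · have e : sidesClass g (4 * (i + 1)) (by omega) = sidesClass g (4 * i + 3 + 1) (by omega) := rfl
      rw [e, h3, h2, h1, h0, commutatorElement_def, inv_inv, inv_inv]
      simp only [mul_assoc]
      rfl
    · intro t
      have h : toSurface g _ = toSurface g _ := Quot.sound (SideRel.alpha i (σ t))
      rw [unitInterval.symm_symm] at h
      exact h
  · intro t
    have h : toSurface g _ = toSurface g _ := Quot.sound (SideRel.beta i (σ t))
    rw [unitInterval.symm_symm] at h
    exact h

/-- The boundary loop: the free side of the polygon. -/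
def boundaryLoop (g : ℕ) : Path (basept g) (basept g) where
  toFun t := toSurface g (sidePoint g (4 * g) t)
  continuous_toFun := (continuous_toSurface g).comp (continuous_sidePoint g _)
  source' := toSurface_vertex g le_rfl
  target' := by rw [sidePoint_last]; rfl

/-- The full circuit of the polygon is contractible in the disc. -/
theorem boundaryLoop_mul (g : ℕ) :
    loopClass (boundaryLoop g) * sidesClass g (4 * g) le_rfl = 1 := by
  have hl : sidePoint g (4 * g + 1) 0 = sidePoint g 0 0 := by
    rw [← sidePoint_one, sidePoint_last]
  have hv : toSurface g (sidePoint g (4 * g + 1) 0) = basept g := by rw [hl]; rfl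
  have h := discClass_trans (toSurface_vertex g (Nat.zero_le _)) (toSurface_vertex g le_rfl) hv
    (sidesPath g (4 * g)) (sidePath g (4 * g))
  have h1 := discClass_refl (g := g) (z := sidePoint g 0 0) rfl
    (((sidesPath g (4 * g)).trans (sidePath g (4 * g))).cast rfl hl.symm)
  exact h.symm.trans h1

theorem mcgAction_boundaryLoop (g : ℕ) (f : MCG g) :
    mcgAction g f (loopClass (boundaryLoop g)) = loopClass (boundaryLoop g) := by
  induction f using QuotientGroup.induction_on with | H f =>
  change inducedHom f _ = _
  rw [inducedHom_loopClass]
  exact congrArg loopClass (Path.ext (funext fun t => f.2 _ ⟨t, rfl⟩))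

theorem mcgAction_sidesClass (g : ℕ) (f : MCG g) :
    mcgAction g f (sidesClass g (4 * g) le_rfl) = sidesClass g (4 * g) le_rfl := by
  rw [← inv_eq_of_mul_eq_one_right (boundaryLoop_mul g), map_inv, mcgAction_boundaryLoop]

theorem sidesClass_zero (g : ℕ) : sidesClass g 0 (Nat.zero_le _) = 1 := discClass_refl _ _

end BoundaryLoop

/-! ### Leading coefficients of noncommutative power series -/

section LeadingCoeff

open PowerSeries

variable {R : Type*} [Ring R]

/-- The power series `p` is divisible by the `k`-th power of the variable. -/
def Vanish (k : ℕ) (p : R⟦X⟧) : Prop := ∀ m < k, coeff m p = 0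

theorem Vanish.mono {k l : ℕ} {p : R⟦X⟧} (h : Vanish k p) (hl : l ≤ k) : Vanish l p :=
  fun m hm => h m (hm.trans_le hl)

theorem vanish_zero (p : R⟦X⟧) : Vanish 0 p := fun _ hm => absurd hm (Nat.not_lt_zero _)

theorem Vanish.add {k : ℕ} {p q : R⟦X⟧} (hp : Vanish k p) (hq : Vanish k q) : Vanish k (p + q) :=
  fun m hm => by rw [map_add, hp m hm, hq m hm, add_zero]

theorem Vanish.neg {k : ℕ} {p : R⟦X⟧} (hp : Vanish k p) : Vanish k (-p) :=
  fun m hm => by rw [map_neg, hp m hm, neg_zero]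

theorem Vanish.sub {k : ℕ} {p q : R⟦X⟧} (hp : Vanish k p) (hq : Vanish k q) : Vanish k (p - q) :=
  fun m hm => by rw [map_sub, hp m hm, hq m hm, sub_zero]

theorem Vanish.mul {k l : ℕ} {p q : R⟦X⟧} (hp : Vanish k p) (hq : Vanish l q) :
    Vanish (k + l) (p * q) := fun m hm => by
  rw [coeff_mul]
  refine Finset.sum_eq_zero fun x hx => ?_
  rw [Finset.HasAntidiagonal.mem_antidiagonal] at hx
  by_cases h : x.1 < k
  · rw [hp _ h, zero_mul]
  · rw [hq x.2 (by omega), mul_zero]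

theorem Vanish.coeff_mul {k l : ℕ} {p q : R⟦X⟧} (hp : Vanish k p) (hq : Vanish l q) :
    coeff (k + l) (p * q) = coeff k p * coeff l q := by
  rw [PowerSeries.coeff_mul, Finset.sum_eq_single (k, l)]
  · rintro ⟨a, b⟩ hx hne
    rw [Finset.HasAntidiagonal.mem_antidiagonal] at hx
    by_cases h : a < k
    · rw [hp _ h, zero_mul]
    · rw [hq b (by by_contra hb; exact hne (Prod.ext (by simp at hx ⊢; omega)
        (by simp at hx ⊢; omega))), mul_zero]
  · intro h
    exact absurd (Finset.HasAntidiagonal.mem_antidiagonal.mpr (by simp)) h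

theorem Vanish.mul_right {k : ℕ} {p : R⟦X⟧} (hp : Vanish k p) (q : R⟦X⟧) : Vanish k (p * q) :=
  hp.mul (vanish_zero q)

theorem Vanish.mul_left {k : ℕ} {p : R⟦X⟧} (hp : Vanish k p) (q : R⟦X⟧) : Vanish k (q * p) := by
  simpa using (vanish_zero q).mul hp

/-- The power series `p` has constant coefficient `1`. -/
theorem coeff_zero_of_vanish {p : R⟦X⟧} (hp : Vanish 1 (p - 1)) : coeff 0 p = 1 := by
  have h := hp 0 one_pos
  rw [map_sub, coeff_zero_one, sub_eq_zero] at h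
  exact h

theorem Vanish.coeff_mul_right {k : ℕ} {p q : R⟦X⟧} (hp : Vanish k p) (hq : Vanish 1 (q - 1)) :
    coeff k (p * q) = coeff k p := by
  have h := hp.coeff_mul (vanish_zero q)
  rwa [coeff_zero_of_vanish hq, mul_one, add_zero] at h

theorem Vanish.coeff_mul_left {k : ℕ} {p q : R⟦X⟧} (hp : Vanish k p) (hq : Vanish 1 (q - 1)) :
    coeff k (q * p) = coeff k p := by
  have h := (vanish_zero q).coeff_mul hp
  rwa [coeff_zero_of_vanish hq, one_mul, zero_add] at h

theorem vanish_mul_sub_one {k : ℕ} {p q : R⟦X⟧} (hp : Vanish k (p - 1)) (hq : Vanish k (q - 1)) :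
    Vanish k (p * q - 1) := by
  rw [show p * q - 1 = (p - 1) * q + (q - 1) by noncomm_ring]
  exact (hp.mul_right q).add hq

theorem coeff_mul_sub_one {k : ℕ} {p q : R⟦X⟧} (hp : Vanish k (p - 1)) (hq : Vanish 1 (q - 1)) :
    coeff k (p * q - 1) = coeff k (p - 1) + coeff k (q - 1) := by
  rw [show p * q - 1 = (p - 1) * q + (q - 1) by noncomm_ring, map_add, hp.coeff_mul_right hq]

theorem units_inv_sub_one (u : R⟦X⟧ˣ) :
    (↑u⁻¹ - 1 : R⟦X⟧) = -((u - 1) * (↑u⁻¹ : R⟦X⟧)) := by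
  rw [sub_mul, Units.mul_inv, one_mul, neg_sub]

theorem vanish_inv_sub_one {k : ℕ} {u : R⟦X⟧ˣ} (hu : Vanish k (u - 1 : R⟦X⟧)) :
    Vanish k (↑u⁻¹ - 1 : R⟦X⟧) := by
  rw [units_inv_sub_one]
  exact (hu.mul_right _).neg

theorem coe_commutator_sub_one (u v : R⟦X⟧ˣ) :
    ((⁅u, v⁆ : R⟦X⟧ˣ) : R⟦X⟧) - 1 =
      (u * v - v * u : R⟦X⟧) * ((↑u⁻¹ : R⟦X⟧) * (↑v⁻¹ : R⟦X⟧)) := by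
  rw [commutatorElement_def, sub_mul]
  have h : (v * u : R⟦X⟧) * ((↑u⁻¹ : R⟦X⟧) * (↑v⁻¹ : R⟦X⟧)) = 1 := by
    rw [mul_assoc, Units.mul_inv_cancel_left, Units.mul_inv]
  rw [h]
  push_cast
  simp only [mul_assoc]

theorem mul_sub_mul_comm (p q : R⟦X⟧) :
    p * q - q * p = (p - 1) * (q - 1) - (q - 1) * (p - 1) := by noncomm_ring

/-! ### Leading coefficients of commutators and of their variation -/

section Commutator

variable {k : ℕ} {u v u' v' : R⟦X⟧ˣ}

theorem vanish_commutator (hu : Vanish 1 (u - 1 : R⟦X⟧)) (hv : Vanish k (v - 1 : R⟦X⟧)) :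
    Vanish (k + 1) (((⁅u, v⁆ : R⟦X⟧ˣ) : R⟦X⟧) - 1) := by
  rw [coe_commutator_sub_one, mul_sub_mul_comm]
  exact ((add_comm 1 k ▸ hu.mul hv).sub (hv.mul hu)).mul_right _

theorem coeff_commutator (hk : 1 ≤ k) (hu : Vanish 1 (u - 1 : R⟦X⟧))
    (hv : Vanish k (v - 1 : R⟦X⟧)) :
    coeff (k + 1) (((⁅u, v⁆ : R⟦X⟧ˣ) : R⟦X⟧) - 1) =
      coeff 1 (u - 1 : R⟦X⟧) * coeff k (v - 1 : R⟦X⟧) -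
        coeff k (v - 1 : R⟦X⟧) * coeff 1 (u - 1 : R⟦X⟧) := by
  have h1 : Vanish (k + 1) ((u - 1 : R⟦X⟧) * (v - 1 : R⟦X⟧)) := add_comm 1 k ▸ hu.mul hv
  rw [coe_commutator_sub_one, mul_sub_mul_comm, Vanish.coeff_mul_right, map_sub,
    hv.coeff_mul hu, add_comm k 1, hu.coeff_mul hv]
  · exact h1.sub (hv.mul hu)
  · exact vanish_mul_sub_one (vanish_inv_sub_one hu) (vanish_inv_sub_one (hv.mono hk))

theorem vanish_inv_sub_inv (hu : Vanish k (u' - u : R⟦X⟧)) :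
    Vanish k ((↑u'⁻¹ : R⟦X⟧) - (↑u⁻¹ : R⟦X⟧)) := by
  have h : ((↑u'⁻¹ : R⟦X⟧) - (↑u⁻¹ : R⟦X⟧)) = -((↑u'⁻¹ : R⟦X⟧) * (u' - u : R⟦X⟧) * (↑u⁻¹ : R⟦X⟧)) := by
    rw [mul_sub, Units.inv_mul, sub_mul, one_mul, mul_assoc, Units.mul_inv, mul_one, neg_sub]
  rw [h]
  exact ((hu.mul_left _).mul_right _).neg

/-- Each commutator minus `1` is `(u v - v u) u⁻¹ v⁻¹`. The first summand varies the factor `u v - v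
u`, in which adding constants to `u` and `v` has no effect; the second varies the inverses. -/
theorem commutator_sub_commutator (u v u' v' : R⟦X⟧ˣ) :
    ((⁅u', v'⁆ : R⟦X⟧ˣ) : R⟦X⟧) - ((⁅u, v⁆ : R⟦X⟧ˣ) : R⟦X⟧) =
      (((u' - u) * (v' - 1) - (v' - 1) * (u' - u)) + ((u - 1) * (v' - v) - (v' - v) * (u - 1))) *
        ((↑u'⁻¹ : R⟦X⟧) * (↑v'⁻¹ : R⟦X⟧)) +
      ((u - 1) * (v - 1) - (v - 1) * (u - 1) : R⟦X⟧) *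
        ((↑u'⁻¹ : R⟦X⟧) * ((↑v'⁻¹ : R⟦X⟧) - (↑v⁻¹ : R⟦X⟧)) +
          ((↑u'⁻¹ : R⟦X⟧) - (↑u⁻¹ : R⟦X⟧)) * (↑v⁻¹ : R⟦X⟧)) := by
  rw [← sub_sub_sub_cancel_right _ _ 1, coe_commutator_sub_one, coe_commutator_sub_one]
  noncomm_ring

/-- The first factor has order `2` and the variation of the inverses has order `k`, so this part is
invisible in degree `k + 1`. -/
theorem vanish_commutator_error (hu : Vanish 1 (u - 1 : R⟦X⟧)) (hv : Vanish 1 (v - 1 : R⟦X⟧))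
    (hu' : Vanish k (u' - u : R⟦X⟧)) (hv' : Vanish k (v' - v : R⟦X⟧)) :
    Vanish (k + 2) (((u - 1) * (v - 1) - (v - 1) * (u - 1) : R⟦X⟧) *
        ((↑u'⁻¹ : R⟦X⟧) * ((↑v'⁻¹ : R⟦X⟧) - (↑v⁻¹ : R⟦X⟧)) +
          ((↑u'⁻¹ : R⟦X⟧) - (↑u⁻¹ : R⟦X⟧)) * (↑v⁻¹ : R⟦X⟧))) := by
  rw [add_comm k 2]
  exact ((hu.mul hv).sub (hv.mul hu)).mul
    (((vanish_inv_sub_inv hv').mul_left _).add ((vanish_inv_sub_inv hu').mul_right _))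

theorem vanish_commutator_main (hu : Vanish 1 (u - 1 : R⟦X⟧)) (hv' : Vanish 1 (v' - 1 : R⟦X⟧))
    (huu : Vanish k (u' - u : R⟦X⟧)) (hvv : Vanish k (v' - v : R⟦X⟧)) :
    Vanish (k + 1) (((u' - u) * (v' - 1) - (v' - 1) * (u' - u)) +
      ((u - 1) * (v' - v) - (v' - v) * (u - 1)) : R⟦X⟧) :=
  ((huu.mul hv').sub (add_comm 1 k ▸ hv'.mul huu)).add
    ((add_comm 1 k ▸ hu.mul hvv).sub (hvv.mul hu))

theorem vanish_one_of_sub (hk : 1 ≤ k) (hv : Vanish 1 (v - 1 : R⟦X⟧))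
    (hv' : Vanish k (v' - v : R⟦X⟧)) : Vanish 1 (v' - 1 : R⟦X⟧) := by
  rw [← sub_add_sub_cancel (v' : R⟦X⟧) v 1]
  exact (hv'.mono hk).add hv

theorem vanish_commutator_sub (hk : 1 ≤ k)
    (hu : Vanish 1 (u - 1 : R⟦X⟧)) (hv : Vanish 1 (v - 1 : R⟦X⟧))
    (hu' : Vanish k (u' - u : R⟦X⟧)) (hv' : Vanish k (v' - v : R⟦X⟧)) :
    Vanish (k + 1) (((⁅u', v'⁆ : R⟦X⟧ˣ) : R⟦X⟧) - ((⁅u, v⁆ : R⟦X⟧ˣ) : R⟦X⟧)) := by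
  rw [commutator_sub_commutator]
  exact ((vanish_commutator_main hu (vanish_one_of_sub hk hv hv') hu' hv').mul_right _).add
    ((vanish_commutator_error hu hv hu' hv').mono (by omega))

/-- The Leibniz rule for commutators in leading degree. The factor `v'` instead of `v` is harmless
later, when the two have the same linear term. -/
theorem coeff_commutator_sub (hk : 1 ≤ k)
    (hu : Vanish 1 (u - 1 : R⟦X⟧)) (hv : Vanish 1 (v - 1 : R⟦X⟧))
    (hu' : Vanish k (u' - u : R⟦X⟧)) (hv' : Vanish k (v' - v : R⟦X⟧)) :
    coeff (k + 1) (((⁅u', v'⁆ : R⟦X⟧ˣ) : R⟦X⟧) - ((⁅u, v⁆ : R⟦X⟧ˣ) : R⟦X⟧)) =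
      (coeff k (u' - u : R⟦X⟧) * coeff 1 (v' - 1 : R⟦X⟧) -
        coeff 1 (v' - 1 : R⟦X⟧) * coeff k (u' - u : R⟦X⟧)) +
      (coeff 1 (u - 1 : R⟦X⟧) * coeff k (v' - v : R⟦X⟧) -
        coeff k (v' - v : R⟦X⟧) * coeff 1 (u - 1 : R⟦X⟧)) := by
  have h1 := vanish_one_of_sub hk hv hv'
  rw [commutator_sub_commutator, map_add, vanish_commutator_error hu hv hu' hv' (k + 1) (by omega),
    add_zero, (vanish_commutator_main hu h1 hu' hv').coeff_mul_right
      (vanish_mul_sub_one (vanish_inv_sub_one (vanish_one_of_sub hk hu hu'))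
        (vanish_inv_sub_one h1)),
    map_add, map_sub, map_sub, hu'.coeff_mul h1, hv'.coeff_mul hu, add_comm k 1, h1.coeff_mul hu',
    hu.coeff_mul hv']

end Commutator

theorem constantCoeff_one_add_monomial (a : R) :
    constantCoeff (1 + monomial 1 a : R⟦X⟧) = ((1 : Rˣ) : R) := by
  rw [← coeff_zero_eq_constantCoeff_apply, map_add, coeff_zero_one, coeff_monomial,
    if_neg zero_ne_one, add_zero, Units.val_one]

/-- The unit `1 + a X`. -/
def oneAddUnit (a : R) : R⟦X⟧ˣ where
  val := 1 + monomial 1 a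
  inv := invOfUnit (1 + monomial 1 a) 1
  val_inv := mul_invOfUnit _ _ (constantCoeff_one_add_monomial a)
  inv_val := invOfUnit_mul _ _ (constantCoeff_one_add_monomial a)

theorem coe_oneAddUnit_sub_one (a : R) : (oneAddUnit a : R⟦X⟧) - 1 = monomial 1 a :=
  add_sub_cancel_left _ _

theorem vanish_oneAddUnit (a : R) : Vanish 1 ((oneAddUnit a : R⟦X⟧) - 1) := fun m hm => by
  rw [coe_oneAddUnit_sub_one, coeff_monomial, if_neg hm.ne]

theorem coeff_oneAddUnit (a : R) : coeff 1 ((oneAddUnit a : R⟦X⟧) - 1) = a := by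
  rw [coe_oneAddUnit_sub_one, coeff_monomial, if_pos rfl]

end LeadingCoeff

/-! ### The first homology and the intersection form -/

section Homology

variable {g : ℕ}

theorem hclass_mul (x y : Pi1 g) : hclass (x * y) = hclass x + hclass y := by
  rw [hclass, map_mul, ofMul_mul, TensorProduct.tmul_add]
  rfl

theorem hclass_one : hclass (1 : Pi1 g) = 0 := by
  rw [hclass, map_one, ofMul_one, TensorProduct.tmul_zero]

theorem hclass_inv (x : Pi1 g) : hclass x⁻¹ = -hclass x :=
  eq_neg_of_add_eq_zero_left (by rw [← hclass_mul, inv_mul_cancel, hclass_one])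

theorem span_hclass : Submodule.span ℚ (Set.range (hclass (g := g))) = ⊤ := by
  refine eq_top_iff.mpr fun v _ => ?_
  induction v using TensorProduct.induction_on with
  | zero => exact zero_mem _
  | tmul q a =>
    obtain ⟨x, rfl⟩ : ∃ x : Pi1 g, Additive.ofMul (Abelianization.of x) = a := by
      obtain ⟨x, hx⟩ := QuotientGroup.mk_surjective a.toMul
      exact ⟨x, hx⟩
    rw [show q ⊗ₜ[ℤ] Additive.ofMul (Abelianization.of x) = q • hclass x by
      rw [hclass, TensorProduct.smul_tmul', smul_eq_mul, mul_one]]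
    exact Submodule.smul_mem _ _ (Submodule.subset_span ⟨x, rfl⟩)
  | add v w hv hw => exact add_mem (hv trivial) (hw trivial)

/-- The linear map on `H` given by a homomorphism on `π` with values in a vector space. -/
def liftHomology {M : Type*} [AddCommGroup M] [Module ℚ M] (φ : Pi1 g →* Multiplicative M) :
    H1 g →ₗ[ℚ] M :=
  LinearMap.liftBaseChange ℚ (AddMonoidHom.toIntLinearMap
    (MonoidHom.toAdditiveLeft (Abelianization.lift φ)))

theorem liftHomology_hclass {M : Type*} [AddCommGroup M] [Module ℚ M]
    (φ : Pi1 g →* Multiplicative M) (x : Pi1 g) : liftHomology φ (hclass x) = (φ x).toAdd := by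
  simp [liftHomology, hclass]

theorem pi1_hom_ext {N : Type*} [Group N] (hg : 1 ≤ g) {φ ψ : Pi1 g →* N}
    (h : ∀ j, φ (loopClass (genLoop j)) = ψ (loopClass (genLoop j))) : φ = ψ := by
  refine MonoidHom.eq_of_eqOn_dense (closure_genLoop hg) ?_
  rintro _ ⟨j, rfl⟩
  exact h j

/-- The homology classes of the side loops. -/
def genClass (j : Fin g ⊕ Fin g) : H1 g := hclass (loopClass (genLoop j))

theorem homology_hom_ext {M : Type*} [AddCommGroup M] [Module ℚ M] (hg : 1 ≤ g)
    {φ ψ : H1 g →ₗ[ℚ] M} (h : ∀ j, φ (genClass j) = ψ (genClass j)) : φ = ψ := by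
  refine LinearMap.ext_on_range span_hclass fun x => ?_
  let toHom (φ : H1 g →ₗ[ℚ] M) : Pi1 g →* Multiplicative M :=
    MonoidHom.mk' (fun x => Multiplicative.ofAdd (φ (hclass x))) fun x y => by
      rw [hclass_mul, map_add, ofAdd_add]
  have : toHom φ = toHom ψ := pi1_hom_ext hg fun j => congrArg Multiplicative.ofAdd (h j)
  exact congrArg Multiplicative.toAdd (DFunLike.congr_fun this x)

/-- The coordinates on `H` with respect to the classes of the side loops. -/
def homologyCoords (hg : 1 ≤ g) : H1 g ≃ₗ[ℚ] (Fin g ⊕ Fin g → ℚ) :=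
  LinearEquiv.ofLinearMap
    (liftHomology ((FreeGroup.lift fun j => Multiplicative.ofAdd (Pi.single j 1)).comp
      (freeEquiv hg).symm.toMonoidHom))
    (Fintype.linearCombination ℚ genClass)
    (by
      refine LinearMap.pi_ext' fun j => LinearMap.ext_ring ?_
      simp [genClass, liftHomology_hclass, ← freeEquiv_of hg])
    (by
      refine homology_hom_ext hg fun j => ?_
      simp [genClass, liftHomology_hclass, ← freeEquiv_of hg])

/-- The classes of the side loops form a basis of `H`. -/
def homologyBasis (hg : 1 ≤ g) : Module.Basis (Fin g ⊕ Fin g) ℚ (H1 g) :=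
  Module.Basis.ofEquivFun (homologyCoords hg)

theorem homologyBasis_apply (hg : 1 ≤ g) (j : Fin g ⊕ Fin g) : homologyBasis hg j = genClass j := by
  simp [homologyBasis, homologyCoords]

theorem repr_genClass (hg : 1 ≤ g) (j j' : Fin g ⊕ Fin g) :
    (homologyBasis hg).repr (genClass j) j' = if j = j' then 1 else 0 := by
  rw [← homologyBasis_apply hg, Module.Basis.repr_self, Finsupp.single_apply]

/-- The intersection form. -/
def intersectionForm (hg : 1 ≤ g) : LinearMap.BilinForm ℚ (H1 g) :=
  LinearMap.mk₂ ℚ (fun x y => ∑ i : Fin g,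
      ((homologyBasis hg).repr x (.inl i) * (homologyBasis hg).repr y (.inr i) -
        (homologyBasis hg).repr x (.inr i) * (homologyBasis hg).repr y (.inl i)))
    (fun x x' y => by
      simp only [map_add, Finsupp.add_apply, ← Finset.sum_add_distrib]
      exact Finset.sum_congr rfl fun i _ => by ring)
    (fun c x y => by
      simp only [map_smul, Finsupp.smul_apply, smul_eq_mul, Finset.mul_sum]
      exact Finset.sum_congr rfl fun i _ => by ring)
    (fun x y y' => by
      simp only [map_add, Finsupp.add_apply, ← Finset.sum_add_distrib]
      exact Finset.sum_congr rfl fun i _ => by ring)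
    (fun c x y => by
      simp only [map_smul, Finsupp.smul_apply, smul_eq_mul, Finset.mul_sum]
      exact Finset.sum_congr rfl fun i _ => by ring)

theorem isIntersectionForm_intersectionForm (hg : 1 ≤ g) :
    IsIntersectionForm g (intersectionForm hg) where
  alt x := by
    simp only [intersectionForm, LinearMap.mk₂_apply]
    exact Finset.sum_eq_zero fun i _ => by ring
  alpha_alpha i j := by
    change intersectionForm hg (genClass (.inl i)) (genClass (.inl j)) = 0
    simp [intersectionForm, repr_genClass]
  beta_beta i j := by
    change intersectionForm hg (genClass (.inr i)) (genClass (.inr j)) = 0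
    simp [intersectionForm, repr_genClass]
  alpha_beta i j := by
    change intersectionForm hg (genClass (.inl i)) (genClass (.inr j)) = _
    simp [intersectionForm, repr_genClass, eq_comm]

/-! ### Recovering vectors and tensors from their pairings under `ω` -/

variable {ω : LinearMap.BilinForm ℚ (H1 g)}

theorem IsIntersectionForm.inl_inl (h : IsIntersectionForm g ω) (i j : Fin g) :
    ω (genClass (.inl i)) (genClass (.inl j)) = 0 := h.alpha_alpha i j

theorem IsIntersectionForm.inr_inr (h : IsIntersectionForm g ω) (i j : Fin g) :
    ω (genClass (.inr i)) (genClass (.inr j)) = 0 := h.beta_beta i j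

theorem IsIntersectionForm.inl_inr (h : IsIntersectionForm g ω) (i j : Fin g) :
    ω (genClass (.inl i)) (genClass (.inr j)) = if i = j then 1 else 0 := h.alpha_beta i j

theorem IsIntersectionForm.swap (h : IsIntersectionForm g ω) (x y : H1 g) : ω x y = -ω y x :=
  (h.alt.neg_eq y x).symm

theorem IsIntersectionForm.inr_inl (h : IsIntersectionForm g ω) (i j : Fin g) :
    ω (genClass (.inr i)) (genClass (.inl j)) = -if i = j then 1 else 0 := by
  rw [h.swap, h.inl_inr]
  simp only [eq_comm]

theorem existsUnique_intersectionForm (hg : 1 ≤ g) : ∃! ω, IsIntersectionForm g ω := by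
  refine ⟨intersectionForm hg, isIntersectionForm_intersectionForm hg, fun ω h => ?_⟩
  have h' := isIntersectionForm_intersectionForm hg
  refine homology_hom_ext hg fun j => homology_hom_ext hg fun j' => ?_
  rcases j with i | i <;> rcases j' with i' | i'
  · rw [h.inl_inl, h'.inl_inl]
  · rw [h.inl_inr, h'.inl_inr]
  · rw [h.inr_inl, h'.inr_inl]
  · rw [h.inr_inr, h'.inr_inr]

theorem IsIntersectionForm.expand (h : IsIntersectionForm g ω) (hg : 1 ≤ g) (y : H1 g) :
    y = ∑ i : Fin g, (ω y (genClass (.inr i)) • genClass (.inl i) -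
      ω y (genClass (.inl i)) • genClass (.inr i)) := by
  let φ : H1 g →ₗ[ℚ] H1 g := ∑ i : Fin g,
    ((ω.flip (genClass (.inr i))).smulRight (genClass (.inl i)) -
      (ω.flip (genClass (.inl i))).smulRight (genClass (.inr i)))
  have hφ : LinearMap.id = φ := by
    refine homology_hom_ext hg fun j => ?_
    rcases j with i | i
    · simp [φ, h.inl_inl, h.inl_inr]
    · simp [φ, h.inr_inl, h.inr_inr]
  simpa [φ] using DFunLike.congr_fun hφ y

theorem contract_tmul {L : Type} [AddCommGroup L] [Module ℚ L] (y h : H1 g) (κ : L) :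
    contract ω h (y ⊗ₜ[ℚ] κ) = ω y h • κ := by
  simp [contract]

/-- A tensor is determined by its contractions with the basis, which is the source of the uniqueness
of the Johnson homomorphism. -/
theorem IsIntersectionForm.tensor_expand (h : IsIntersectionForm g ω) (hg : 1 ≤ g) {L : Type}
    [AddCommGroup L] [Module ℚ L] (z : H1 g ⊗[ℚ] L) :
    z = ∑ i : Fin g, (genClass (.inl i) ⊗ₜ[ℚ] contract ω (genClass (.inr i)) z -
      genClass (.inr i) ⊗ₜ[ℚ] contract ω (genClass (.inl i)) z) := by
  induction z using TensorProduct.induction_on with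
  | zero => simp
  | tmul y κ =>
    conv_lhs => rw [h.expand hg y]
    simp only [contract_tmul, TensorProduct.sum_tmul, TensorProduct.sub_tmul,
      TensorProduct.tmul_smul, TensorProduct.smul_tmul']
  | add z w hz hw =>
    conv_lhs => rw [hz, hw]
    simp only [map_add, TensorProduct.tmul_add, ← Finset.sum_add_distrib]
    exact Finset.sum_congr rfl fun i _ => by abel

end Homology

/-! ### The Magnus expansion and the symbol maps -/

section Magnus

open PowerSeries

attribute [local instance] LieRing.ofAssociativeRing

variable {g : ℕ} (hg : 1 ≤ g)

/-- The Magnus expansion of `π`: the side loop with homology class `h` is sent to `1 + h X`. -/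
def magnus : Pi1 g →* (TensorAlgebra ℚ (H1 g))⟦X⟧ˣ :=
  (FreeGroup.lift fun j => oneAddUnit (TensorAlgebra.ι ℚ (genClass j))).comp
    (freeEquiv hg).symm.toMonoidHom

/-- The Magnus expansion minus its constant term. -/
def magnusTail (x : Pi1 g) : (TensorAlgebra ℚ (H1 g))⟦X⟧ := (magnus hg x : _⟦X⟧) - 1

theorem magnus_gen (j : Fin g ⊕ Fin g) :
    magnus hg (loopClass (genLoop j)) = oneAddUnit (TensorAlgebra.ι ℚ (genClass j)) := by
  simp [magnus, ← freeEquiv_of hg]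

theorem vanish_magnusTail_mul {k : ℕ} {x y : Pi1 g} (hx : Vanish k (magnusTail hg x))
    (hy : Vanish k (magnusTail hg y)) : Vanish k (magnusTail hg (x * y)) := by
  rw [magnusTail, map_mul, Units.val_mul]
  exact vanish_mul_sub_one hx hy

theorem vanish_magnusTail_one (k : ℕ) : Vanish k (magnusTail hg 1) := by
  intro m _
  rw [magnusTail, map_one, Units.val_one, sub_self, map_zero]

theorem vanish_magnusTail_inv {k : ℕ} {x : Pi1 g} (hx : Vanish k (magnusTail hg x)) :
    Vanish k (magnusTail hg x⁻¹) := by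
  rw [magnusTail, map_inv]
  exact vanish_inv_sub_one hx

theorem vanish_magnusTail (x : Pi1 g) : Vanish 1 (magnusTail hg x) := by
  have hx : x ∈ Subgroup.closure (Set.range fun j : Fin g ⊕ Fin g => loopClass (genLoop j)) := by
    rw [closure_genLoop hg]; trivial
  induction hx using Subgroup.closure_induction with
  | mem x hx =>
    obtain ⟨j, rfl⟩ := hx
    rw [magnusTail, magnus_gen]
    exact vanish_oneAddUnit _
  | one => exact vanish_magnusTail_one hg 1
  | mul x y _ _ hx hy => exact vanish_magnusTail_mul hg hx hy
  | inv x _ hx => exact vanish_magnusTail_inv hg hx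

theorem coeff_magnusTail_mul {k : ℕ} {x : Pi1 g} (hx : Vanish k (magnusTail hg x)) (y : Pi1 g) :
    coeff k (magnusTail hg (x * y)) = coeff k (magnusTail hg x) + coeff k (magnusTail hg y) := by
  rw [magnusTail, map_mul, Units.val_mul]
  exact coeff_mul_sub_one hx (vanish_magnusTail hg y)

theorem coeff_magnusTail_one (k : ℕ) : coeff k (magnusTail hg 1) = 0 :=
  vanish_magnusTail_one hg (k + 1) k (Nat.lt_succ_self k)

theorem coeff_magnusTail_inv {k : ℕ} {x : Pi1 g} (hx : Vanish k (magnusTail hg x)) :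
    coeff k (magnusTail hg x⁻¹) = -coeff k (magnusTail hg x) := by
  refine eq_neg_of_add_eq_zero_right ?_
  rw [← coeff_magnusTail_mul hg hx, mul_inv_cancel, coeff_magnusTail_one]

/-- Both sides are homomorphisms on `π` that agree on the side loops. -/
theorem coeff_one_magnusTail (x : Pi1 g) :
    coeff 1 (magnusTail hg x) = TensorAlgebra.ι ℚ (hclass x) := by
  let φ : Pi1 g →* Multiplicative (TensorAlgebra ℚ (H1 g)) :=
    MonoidHom.mk' (fun x => .ofAdd (coeff 1 (magnusTail hg x))) fun x y => by
      rw [coeff_magnusTail_mul hg (vanish_magnusTail hg x), ofAdd_add]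
  let ψ : Pi1 g →* Multiplicative (TensorAlgebra ℚ (H1 g)) :=
    MonoidHom.mk' (fun x => .ofAdd (TensorAlgebra.ι ℚ (hclass x))) fun x y => by
      rw [hclass_mul, map_add, ofAdd_add]
  have h : φ = ψ := pi1_hom_ext hg fun j => by
    refine congrArg Multiplicative.ofAdd ?_
    rw [magnusTail, magnus_gen, coeff_oneAddUnit]
    rfl
  exact congrArg Multiplicative.toAdd (DFunLike.congr_fun h x)

theorem vanish_magnusTail_commutator {k : ℕ} (x : Pi1 g) {w : Pi1 g}
    (hw : Vanish k (magnusTail hg w)) : Vanish (k + 1) (magnusTail hg ⁅x, w⁆) := by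
  rw [magnusTail, map_commutatorElement]
  exact vanish_commutator (vanish_magnusTail hg x) hw

theorem coeff_magnusTail_commutator {k : ℕ} (hk : 1 ≤ k) (x : Pi1 g) {w : Pi1 g}
    (hw : Vanish k (magnusTail hg w)) : coeff (k + 1) (magnusTail hg ⁅x, w⁆) =
      ⁅TensorAlgebra.ι ℚ (hclass x), coeff k (magnusTail hg w)⁆ := by
  rw [magnusTail, map_commutatorElement, coeff_commutator hk (vanish_magnusTail hg x) hw,
    Ring.lie_def, ← coeff_one_magnusTail hg]
  rfl

/-- The elements of `π` whose Magnus expansion has leading term in `L_k(H)`. -/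
def magnusSubgroup (k : ℕ) : Subgroup (Pi1 g) where
  carrier := {w | Vanish k (magnusTail hg w) ∧ coeff k (magnusTail hg w) ∈ freeLieDeg (H1 g) k}
  one_mem' := ⟨vanish_magnusTail_one hg k, by rw [coeff_magnusTail_one]; exact zero_mem _⟩
  mul_mem' hx hy := ⟨vanish_magnusTail_mul hg hx.1 hy.1, by
    rw [coeff_magnusTail_mul hg hx.1]; exact add_mem hx.2 hy.2⟩
  inv_mem' hx := ⟨vanish_magnusTail_inv hg hx.1, by
    rw [coeff_magnusTail_inv hg hx.1]; exact neg_mem hx.2⟩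

/-- A commutator with an element of `π` raises the order by one and brackets the leading coefficient
with an element of `H`. Only this inclusion is needed, not the converse description of `γ_k(π)` by
orders of vanishing. -/
theorem gam_le_magnusSubgroup (n : ℕ) : gam g (n + 1) ≤ magnusSubgroup hg (n + 1) := by
  induction n with
  | zero =>
    intro x _
    exact ⟨vanish_magnusTail hg x, by
      rw [coeff_one_magnusTail]; exact ι_mem_freeLieDeg _⟩
  | succ n ih =>
    change ⁅gam g (n + 1), (⊤ : Subgroup (Pi1 g))⁆ ≤ _
    refine Subgroup.commutator_le.mpr fun w hw x _ => ?_
    rw [← commutatorElement_inv]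
    refine inv_mem ?_
    obtain ⟨h1, h2⟩ := ih hw
    exact ⟨vanish_magnusTail_commutator hg x h1, by
      rw [coeff_magnusTail_commutator hg (Nat.le_add_left 1 n) x h1]
      exact lie_ι_mem_freeLieDeg _ h2⟩

/-- The symbol maps, given by the leading terms of the Magnus expansion. -/
def symbol (n : ℕ) : Additive (gam g (n + 1)) →+ freeLieDeg (H1 g) (n + 1) :=
  AddMonoidHom.mk' (fun w => ⟨coeff (n + 1) (magnusTail hg w.toMul.1),
      (gam_le_magnusSubgroup hg n w.toMul.2).2⟩)
    fun w w' => Subtype.ext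
      (coeff_magnusTail_mul hg (gam_le_magnusSubgroup hg n w.toMul.2).1 w'.toMul.1)

theorem isSymbol_symbol : IsSymbol g (symbol hg) where
  degree_one x := Subtype.ext (coeff_one_magnusTail hg x.1)
  commutator n x w := Subtype.ext (coeff_magnusTail_commutator hg (Nat.le_add_left 1 n) x
    (gam_le_magnusSubgroup hg n w.2).1)

theorem IsSymbol.unique {σ σ' : ∀ n : ℕ, Additive (gam g (n + 1)) →+ freeLieDeg (H1 g) (n + 1)}
    (h : IsSymbol g σ) (h' : IsSymbol g σ') : σ = σ' := by
  funext n
  induction n with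
  | zero => exact AddMonoidHom.ext fun x => (h.degree_one x.toMul).trans (h'.degree_one x.toMul).symm
  | succ n ih =>
    -- The locus where the two symbols agree, regarded inside `π` so that the generating commutators
    -- of the lower central series can be tested there.
    let K : Subgroup (Pi1 g) :=
      ((AddMonoidHom.eqLocus (σ (n + 1)) (σ' (n + 1))).toSubgroup').map (gam g (n + 2)).subtype
    have hK : gam g (n + 2) ≤ K := by
      change ⁅gam g (n + 1), (⊤ : Subgroup (Pi1 g))⁆ ≤ _
      refine Subgroup.commutator_le.mpr fun w hw x _ => ?_
      rw [← commutatorElement_inv]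
      refine inv_mem ⟨commElt x ⟨w, hw⟩, ?_, rfl⟩
      have e := h.commutator n x ⟨w, hw⟩
      rw [ih] at e
      exact e.trans (h'.commutator n x ⟨w, hw⟩).symm
    refine AddMonoidHom.ext fun w => ?_
    obtain ⟨v, hv, hvw⟩ := hK w.toMul.2
    obtain rfl : v = w.toMul := Subtype.ext hvw
    exact hv

theorem existsUnique_symbol (hg : 1 ≤ g) : ∃! σ, IsSymbol g σ :=
  ⟨symbol hg, isSymbol_symbol hg, fun _ h => h.unique (isSymbol_symbol hg)⟩

end Magnus

/-! ### The Johnson homomorphism -/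

section JohnsonHom

open PowerSeries

attribute [local instance] LieRing.ofAssociativeRing

variable {g d : ℕ} (hg : 1 ≤ g)

/-- The change of the Magnus expansion of `x` under `f`. -/
def magnusDiff (f : MCG g) (x : Pi1 g) : (TensorAlgebra ℚ (H1 g))⟦X⟧ :=
  (magnus hg (mcgAction g f x) : (TensorAlgebra ℚ (H1 g))⟦X⟧) - (magnus hg x : (TensorAlgebra ℚ (H1 g))⟦X⟧)

theorem magnusDiff_eq (f : johnsonFiltration g d) (x : Pi1 g) :
    magnusDiff hg f.1 x = magnusTail hg (leftDiff f x).1 * (magnus hg x : (TensorAlgebra ℚ (H1 g))⟦X⟧) := by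
  change _ = magnusTail hg (mcgAction g f.1 x * x⁻¹) * _
  rw [magnusDiff, magnusTail, sub_mul, one_mul, ← Units.val_mul, ← map_mul, inv_mul_cancel_right]

theorem vanish_magnusDiff (f : johnsonFiltration g d) (x : Pi1 g) :
    Vanish (d + 1) (magnusDiff hg f.1 x) := by
  rw [magnusDiff_eq]
  exact (gam_le_magnusSubgroup hg d (leftDiff f x).2).1.mul_right _

/-- The difference is the tail of `f(x) x⁻¹` times a series with constant term `1`, a factor that
leaves the leading coefficient unchanged. Symbols can thus be computed from differences, which obey
a Leibniz rule. -/
theorem coeff_magnusDiff (f : johnsonFiltration g d) (x : Pi1 g) :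
    coeff (d + 1) (magnusDiff hg f.1 x) = symbol hg d (Additive.ofMul (leftDiff f x)) := by
  rw [magnusDiff_eq, (gam_le_magnusSubgroup hg d (leftDiff f x).2).1.coeff_mul_right
    (vanish_magnusTail hg x)]
  rfl

theorem magnusDiff_mul (f : MCG g) (x y : Pi1 g) : magnusDiff hg f (x * y) =
    magnusDiff hg f x * (magnus hg (mcgAction g f y) : (TensorAlgebra ℚ (H1 g))⟦X⟧) +
      (magnus hg x : (TensorAlgebra ℚ (H1 g))⟦X⟧) * magnusDiff hg f y := by
  simp only [magnusDiff, map_mul, Units.val_mul]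
  noncomm_ring

theorem coeff_magnusDiff_mul {k : ℕ} (f : MCG g) (x y : Pi1 g) (hx : Vanish k (magnusDiff hg f x))
    (hy : Vanish k (magnusDiff hg f y)) :
    coeff k (magnusDiff hg f (x * y)) = coeff k (magnusDiff hg f x) + coeff k (magnusDiff hg f y) := by
  rw [magnusDiff_mul, map_add, hx.coeff_mul_right (vanish_magnusTail hg _),
    hy.coeff_mul_left (vanish_magnusTail hg _)]

theorem vanish_magnusDiff_mul {k : ℕ} (f : MCG g) (x y : Pi1 g)
    (hx : Vanish k (magnusDiff hg f x)) (hy : Vanish k (magnusDiff hg f y)) :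
    Vanish k (magnusDiff hg f (x * y)) := by
  rw [magnusDiff_mul]
  exact (hx.mul_right _).add (hy.mul_left _)

/-- The element `⟦f(x) x⁻¹⟧` of `L_{d+1}(H)`. -/
def johnsonValue (f : johnsonFiltration g d) (x : Pi1 g) : freeLieDeg (H1 g) (d + 1) :=
  symbol hg d (Additive.ofMul (leftDiff f x))

theorem johnsonValue_mul (f : johnsonFiltration g d) (x y : Pi1 g) :
    johnsonValue hg f (x * y) = johnsonValue hg f x + johnsonValue hg f y := by
  refine Subtype.ext ?_
  simp only [johnsonValue, Submodule.coe_add, ← coeff_magnusDiff]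
  exact coeff_magnusDiff_mul hg _ _ _ (vanish_magnusDiff hg f x) (vanish_magnusDiff hg f y)

/-- The linear map `H → L_{d+1}(H)` given by `f`. -/
def johnsonLinear (f : johnsonFiltration g d) : H1 g →ₗ[ℚ] freeLieDeg (H1 g) (d + 1) :=
  liftHomology (MonoidHom.mk' (fun x => .ofAdd (johnsonValue hg f x)) fun x y => by
    rw [johnsonValue_mul, ofAdd_add])

theorem johnsonLinear_hclass (f : johnsonFiltration g d) (x : Pi1 g) :
    johnsonLinear hg f (hclass x) = johnsonValue hg f x := by
  rw [johnsonLinear, liftHomology_hclass]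
  rfl

theorem hclass_of_mem_gam_two {x : Pi1 g} (hx : x ∈ gam g 2) : hclass x = 0 := by
  have h : Abelianization.of x = 1 := by
    have : x ∈ commutator (Pi1 g) := hx
    rwa [← Abelianization.ker_of, MonoidHom.mem_ker] at this
  rw [hclass, h, ofMul_one, TensorProduct.tmul_zero]

/-- For `d ≥ 1` the element `f(x) x⁻¹` lies in `γ_2(π)`. -/
theorem hclass_mcgAction (hd : 1 ≤ d) (f : johnsonFiltration g d) (x : Pi1 g) :
    hclass (mcgAction g f.1 x) = hclass x := by
  have h : mcgAction g f.1 x * x⁻¹ ∈ gam g 2 :=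
    Subgroup.lowerCentralSeries_antitone (⊤ : Subgroup (Pi1 g)) (by omega : 2 - 1 ≤ d + 1 - 1)
      (leftDiff f x).2
  have h' := hclass_of_mem_gam_two h
  rwa [hclass_mul, hclass_inv, ← sub_eq_add_neg, sub_eq_zero] at h'

/-- The change of `x` under `f h` is the change of `h(x)` under `f` plus that of `x` under `h`. The
first depends only on the homology class, which `h` preserves. -/
theorem johnsonLinear_mul (hd : 1 ≤ d) (f h : johnsonFiltration g d) :
    johnsonLinear hg (f * h) = johnsonLinear hg f + johnsonLinear hg h := by
  refine LinearMap.ext_on_range span_hclass fun x => ?_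
  have e : johnsonLinear hg f (hclass x) = johnsonValue hg f (mcgAction g h.1 x) := by
    rw [← hclass_mcgAction hd h x, johnsonLinear_hclass]
  rw [LinearMap.add_apply, e, johnsonLinear_hclass, johnsonLinear_hclass]
  refine Subtype.ext ?_
  simp only [johnsonValue, Submodule.coe_add, ← coeff_magnusDiff]
  rw [← map_add]
  congr 1
  simp [magnusDiff, MulAut.mul_apply]

variable {ω : LinearMap.BilinForm ℚ (H1 g)}

/-- The tensor that corresponds to a linear map on `H` under the identification given by `ω`. -/
def dualTensor {L : Type} [AddCommGroup L] [Module ℚ L] (φ : H1 g →ₗ[ℚ] L) : H1 g ⊗[ℚ] L :=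
  ∑ i : Fin g, (genClass (.inl i) ⊗ₜ[ℚ] φ (genClass (.inr i)) -
    genClass (.inr i) ⊗ₜ[ℚ] φ (genClass (.inl i)))

theorem IsIntersectionForm.contract_dualTensor (hω : IsIntersectionForm g ω) (hg : 1 ≤ g) {L : Type}
    [AddCommGroup L] [Module ℚ L] (φ : H1 g →ₗ[ℚ] L) (y : H1 g) :
    contract ω y (dualTensor φ) = φ y := by
  conv_rhs => rw [hω.expand hg y]
  simp only [dualTensor, map_sum, map_sub, contract_tmul, map_smul]
  refine Finset.sum_congr rfl fun i _ => ?_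
  rw [hω.swap _ y, hω.swap _ y, neg_smul, neg_smul]
  abel

theorem IsIntersectionForm.eq_dualTensor (hω : IsIntersectionForm g ω) (hg : 1 ≤ g) {L : Type}
    [AddCommGroup L] [Module ℚ L] {φ : H1 g →ₗ[ℚ] L} {z : H1 g ⊗[ℚ] L}
    (h : ∀ x : Pi1 g, contract ω (hclass x) z = φ (hclass x)) : z = dualTensor φ := by
  conv_lhs => rw [hω.tensor_expand hg z]
  exact Finset.sum_congr rfl fun i _ => by rw [genClass, genClass, h, h]

theorem existsUnique_johnsonHom (hd : 1 ≤ d) (hω : IsIntersectionForm g ω) :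
    ∃! τ, IsJohnsonHom g d ω (symbol hg) τ := by
  refine ⟨AddMonoidHom.mk' (fun f => dualTensor (johnsonLinear hg f.toMul)) fun f h => ?_,
    fun f x => ?_, fun τ hτ => AddMonoidHom.ext fun f => ?_⟩
  · simp only [toMul_add, johnsonLinear_mul hg hd, dualTensor, LinearMap.add_apply,
      TensorProduct.tmul_add, ← Finset.sum_add_distrib]
    exact Finset.sum_congr rfl fun i _ => by abel
  · exact (hω.contract_dualTensor hg _ _).trans (johnsonLinear_hclass hg f x)
  · exact hω.eq_dualTensor hg fun x => (hτ f.toMul x).trans (johnsonLinear_hclass hg f.toMul x).symm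

/-! ### The image of the Johnson homomorphism -/

/-- The contribution of the handle number `i` to the bracket of the Johnson homomorphism. -/
def handleTerm (f : johnsonFiltration g d) (i : Fin g) : TensorAlgebra ℚ (H1 g) :=
  ⁅TensorAlgebra.ι ℚ (genClass (.inl i)), (johnsonLinear hg f (genClass (.inr i))).1⁆ -
    ⁅TensorAlgebra.ι ℚ (genClass (.inr i)), (johnsonLinear hg f (genClass (.inl i))).1⁆

theorem vanish_magnusDiff_commutator (f : johnsonFiltration g d) (x y : Pi1 g) :
    Vanish (d + 2) (magnusDiff hg f.1 ⁅x, y⁆) := by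
  rw [magnusDiff, map_commutatorElement, map_commutatorElement, map_commutatorElement]
  exact vanish_commutator_sub (Nat.le_add_left 1 d) (vanish_magnusTail hg x)
    (vanish_magnusTail hg y) (vanish_magnusDiff hg f x) (vanish_magnusDiff hg f y)

theorem coeff_magnusDiff_commutator (hd : 1 ≤ d) (f : johnsonFiltration g d) (x y : Pi1 g) :
    coeff (d + 2) (magnusDiff hg f.1 ⁅x, y⁆) =
      ⁅TensorAlgebra.ι ℚ (hclass x), (johnsonLinear hg f (hclass y)).1⁆ -
        ⁅TensorAlgebra.ι ℚ (hclass y), (johnsonLinear hg f (hclass x)).1⁆ := by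
  rw [magnusDiff, map_commutatorElement, map_commutatorElement, map_commutatorElement,
    coeff_commutator_sub (Nat.le_add_left 1 d) (vanish_magnusTail hg x)
      (vanish_magnusTail hg y) (vanish_magnusDiff hg f x) (vanish_magnusDiff hg f y)]
  have hx := coeff_magnusDiff hg f x
  have hy := coeff_magnusDiff hg f y
  have h1 := coeff_one_magnusTail hg x
  have h2 := coeff_one_magnusTail hg (mcgAction g f.1 y)
  rw [hclass_mcgAction hd] at h2
  rw [magnusDiff] at hx hy
  rw [magnusTail] at h1 h2
  rw [hx, hy, h1, h2, johnsonLinear_hclass, johnsonLinear_hclass, Ring.lie_def, Ring.lie_def]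
  simp only [johnsonValue]
  abel

/-- Changes of order `d + 2` add up over the handles. The inverses in `[β⁻¹, α⁻¹]` contribute two
signs that cancel; the minus sign comes from `β` standing before `α`. -/
theorem magnusDiff_sidesClass (hd : 1 ≤ d) (f : johnsonFiltration g d) (k : ℕ) (hk : k ≤ g) :
    Vanish (d + 2) (magnusDiff hg f.1 (sidesClass g (4 * k) (by omega))) ∧
      coeff (d + 2) (magnusDiff hg f.1 (sidesClass g (4 * k) (by omega))) =
        -∑ i : Fin k, handleTerm hg f (i.castLE hk) := by
  induction k with
  | zero =>
    have h : magnusDiff hg f.1 (sidesClass g (4 * 0) (by omega)) = 0 := by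
      rw [show sidesClass g (4 * 0) (by omega) = 1 from sidesClass_zero g, magnusDiff, map_one,
        map_one, sub_self]
    rw [h]
    exact ⟨fun m _ => map_zero _, by simp⟩
  | succ k ih =>
    obtain ⟨h1, h2⟩ := ih (Nat.le_of_succ_le hk)
    have e := sidesClass_block (⟨k, hk⟩ : Fin g)
    simp only at e
    rw [e]
    have hc := vanish_magnusDiff_commutator hg f (loopClass (betaLoop g ⟨k, hk⟩))⁻¹
      (loopClass (alphaLoop g ⟨k, hk⟩))⁻¹
    refine ⟨vanish_magnusDiff_mul hg _ _ _ hc h1, ?_⟩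
    rw [coeff_magnusDiff_mul hg _ _ _ hc h1, h2, coeff_magnusDiff_commutator hg hd,
      Fin.sum_univ_castSucc, hclass_inv, hclass_inv]
    simp only [map_neg, neg_lie, lie_neg, Submodule.coe_neg, neg_neg]
    have e2 : handleTerm hg f (Fin.castLE hk (Fin.last k)) =
      ⁅TensorAlgebra.ι ℚ (hclass (loopClass (alphaLoop g ⟨k, hk⟩))),
        (johnsonLinear hg f (hclass (loopClass (betaLoop g ⟨k, hk⟩)))).1⁆ -
      ⁅TensorAlgebra.ι ℚ (hclass (loopClass (betaLoop g ⟨k, hk⟩))),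
        (johnsonLinear hg f (hclass (loopClass (alphaLoop g ⟨k, hk⟩)))).1⁆ := rfl
    rw [e2]
    simp only [Fin.castLE_castSucc]
    abel

/-- The complete boundary word is fixed by `f`, so its Magnus expansion does not change. -/
theorem sum_handleTerm (hd : 1 ≤ d) (f : johnsonFiltration g d) : ∑ i, handleTerm hg f i = 0 := by
  have h := (magnusDiff_sidesClass hg hd f g le_rfl).2
  rw [magnusDiff, mcgAction_sidesClass, sub_self, map_zero, eq_comm, neg_eq_zero] at h
  exact h

theorem coe_lieBracketMap_tmul {V : Type} [AddCommGroup V] [Module ℚ V] (k : ℕ) (v : V)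
    (u : freeLieDeg V k) : (lieBracketMap V k (v ⊗ₜ[ℚ] u) : TensorAlgebra ℚ V) =
      ⁅TensorAlgebra.ι ℚ v, u.1⁆ := rfl

theorem lieBracketMap_dualTensor (hd : 1 ≤ d) (f : johnsonFiltration g d) :
    lieBracketMap (H1 g) (d + 1) (dualTensor (johnsonLinear hg f)) = 0 := by
  refine Subtype.ext ?_
  rw [dualTensor, map_sum, Submodule.coe_sum, Submodule.coe_zero, ← sum_handleTerm hg hd f]
  exact Finset.sum_congr rfl fun i _ => by
    rw [map_sub, Submodule.coe_sub, coe_lieBracketMap_tmul, coe_lieBracketMap_tmul]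
    rfl

end JohnsonHom

end

end Johnson

theorem mainTheorem5 (g d : ℕ) (hg : 1 ≤ g) (hd : 1 ≤ d) :
    (∃! ω, Johnson.IsIntersectionForm g ω) ∧
    (∃! σ, Johnson.IsSymbol g σ) ∧
    ∀ ω σ, Johnson.IsIntersectionForm g ω → Johnson.IsSymbol g σ →
      (∃! τ, Johnson.IsJohnsonHom g d ω σ τ) ∧
      ∀ τ, Johnson.IsJohnsonHom g d ω σ τ →
        τ.range ≤ (LinearMap.ker
          (Johnson.lieBracketMap (Johnson.H1 g) (d + 1))).toAddSubgroup := by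
  refine ⟨Johnson.existsUnique_intersectionForm hg, Johnson.existsUnique_symbol hg,
    fun ω σ hω hσ => ?_⟩
  -- By uniqueness the given symbol maps are those of the Magnus expansion, in which the computation
  -- takes place.
  obtain rfl := hσ.unique (Johnson.isSymbol_symbol hg)
  refine ⟨Johnson.existsUnique_johnsonHom hg hd hω, ?_⟩
  rintro τ hτ _ ⟨f, rfl⟩
  have h : τ f = Johnson.dualTensor (Johnson.johnsonLinear hg f.toMul) :=
    hω.eq_dualTensor hg fun x =>
      (hτ f.toMul x).trans (Johnson.johnsonLinear_hclass hg f.toMul x).symm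
  change Johnson.lieBracketMap (Johnson.H1 g) (d + 1) (τ f) = 0
  rw [h]
  exact Johnson.lieBracketMap_dualTensor hg hd f.toMul
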